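/- Let $\mathsf{RCA}_0^\omega=\mathsf{E\text{-}PRA}^\omega+\mathsf{QF\text{-}AC}^{1,0}$ be Kohlenbach's base theory of higher-order reverse mathematics. It is formulated in classical many-sorted logic over all finite types, with equality $=_0$ at type $0$ as the only primitive predicate (equality at higher types is defined extensionally) and with the constants $0$, $S$, the combinators $\Pi,\Sigma$, and the recursor $R_0$ of type $0$. Its axioms are the equality and successor axioms, the defining equations of the constants, full extensionality, induction for quantifier-free formulas, and the schema $(\forall f^1)(\exists n^0)\varphi(f,n)\to(\exists F^2)(\forall f^1)\varphi(f,F(f))$ for quantifier-free $\varphi$. Sets are given by binary characteristic functions of type $1=0\to0$. A *stable 2-colouring* is a $c^1$ that assigns to (the code of) every pair $x<y$ a colour $c(x,y)\in\{0,1\}$ such that $(\forall x)(\exists i)(\exists m)(\forall y)\,[x<y\wedge m<y\to c(x,y)=i]$. A set $H$ is *infinite homogeneous* for $c$ if $(\forall k)(\exists x)[k<x\wedge x\in H]$ and $(\exists i)(\forall x,y\in H)[x<y\to c(x,y)=i]$. For $\Psi^{1\to1}$, $\mu^2$ and $\Theta^{1\to 1}$ write - $\mathsf{USRT}^2_2(\Psi)$: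 for every stable 2-colouring $c$, $\Psi(c)$ is an infinite homogeneous set for $c$; - $\mathsf{MU}(\mu)$: $(\forall f^1)[(\exists n)f(n)=0\to f(\mu(f))=0]$; - $\mathsf{SEARCH}(\Psi,\Theta)$: for every stable 2-colouring $c$ and every $k$, $\Theta(c)(k)>k$ and $\Theta(c)(k)\in\Psi(c)$; and let $\mathsf{USRT}^2_2$ be $(\exists\Psi)\mathsf{USRT}^2_2(\Psi)$ and $(\mu^2)$ be $(\exists\mu)\mathsf{MU}(\mu)$. **Theorem.** $\mathsf{RCA}_0^\omega$ proves the explicit equivalence $\mathsf{USRT}^2_2\leftrightarrow(\mu^2)$. That is: 1. $\mathsf{RCA}_0^\omega\vdash\mathsf{USRT}^2_2\leftrightarrow(\mu^2)$. 2. $\mathsf{RCA}_0^\omega\vdash(\forall\Psi)[\mathsf{USRT}^2_2(\Psi)\to(\exists\Theta)\,\mathsf{SEARCH}(\Psi,\Theta)]$, and there is a closed term $t$ of the language of $\mathsf{RCA}_0^\omega$ such that $\mathsf{RCA}_0^\omega\vdash(\forall\Psi)(\forall\Theta)[\mathsf{USRT}^2_2(\Psi)\wedge\mathsf{SEARCH}(\Psi,\Theta)\to\mathsf{MU}(t(\Psi,\Theta))]$.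 3. There is a closed term $s$ of the language such that $\mathsf{RCA}_0^\omega\vdash(\forall\mu)[\mathsf{MU}(\mu)\to\mathsf{USRT}^2_2(s(\mu))]$. -/

import Mathlib

namespace HigherOrderRM

/-! ## The language of arithmetic in all finite types -/

/-- Finite types: the type `0` of natural numbers, and `σ ⇒ τ`. -/
inductive FinTy : Type where
  | zero : FinTy
  | arrow : FinTy → FinTy → FinTy
  deriving DecidableEq

infixr:60 " ⇒ " => FinTy.arrow

/-- The type `0` of natural numbers. -/
abbrev ty0 : FinTy := FinTy.zero

/-- The type `1` of number-theoretic functions (and of sets, given by characteristic functions). -/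
abbrev ty1 : FinTy := ty0 ⇒ ty0

/-- The type `2`. -/
abbrev ty2 : FinTy := ty1 ⇒ ty0

/-- The type `1 → 1`. -/
abbrev ty11 : FinTy := ty1 ⇒ ty1

/-- Terms. Variables are de Bruijn indices, counted separately for every type: a quantifier over
type `σ` binds the index `0` of type `σ` and affects no variable of another type.
`K` and `Sc` are the combinators (written `Π` and `Σ` in the literature) and `rec0` is the recursor
for type `0` only. -/
inductive Tm : FinTy → Type where
  | var (σ : FinTy) (n : ℕ) : Tm σ
  | app {σ τ : FinTy} (f : Tm (σ ⇒ τ)) (x : Tm σ) : Tm τ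
  | zero : Tm ty0
  | succ : Tm (ty0 ⇒ ty0)
  | K (σ τ : FinTy) : Tm (σ ⇒ τ ⇒ σ)
  | Sc (ρ σ τ : FinTy) : Tm ((ρ ⇒ σ ⇒ τ) ⇒ (ρ ⇒ σ) ⇒ ρ ⇒ τ)
  | rec0 : Tm (ty0 ⇒ ty0 ⇒ (ty0 ⇒ ty0 ⇒ ty0) ⇒ ty0)

infixl:80 " ⬝ " => Tm.app

/-- Closed terms: those without variables (terms contain no binders). -/
def Tm.Closed : {σ : FinTy} → Tm σ → Prop
  | _, .var _ _ => False
  | _, .app f x => f.Closed ∧ x.Closed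
  | _, _ => True

/-- Simultaneous substitutions. -/
abbrev Sub : Type := (σ : FinTy) → ℕ → Tm σ

def Tm.subst (s : Sub) : {σ : FinTy} → Tm σ → Tm σ
  | _, .var σ n => s σ n
  | _, .app f x => .app (f.subst s) (x.subst s)
  | _, .zero => .zero
  | _, .succ => .succ
  | _, .K σ τ => .K σ τ
  | _, .Sc ρ σ τ => .Sc ρ σ τ
  | _, .rec0 => .rec0

/-- The identity substitution. -/
def Sub.id : Sub := fun σ n => .var σ n

/-- Increase the index of every variable of type `σ` by one. -/
def Sub.shift (σ : FinTy) : Sub := fun τ n => .var τ (if τ = σ then n + 1 else n)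

/-- Send the variable `0` of type `σ` to `t`, the variable `n + 1` of type `σ` to `s σ n`, and a
variable `n` of another type `τ` to `s τ n`. -/
def Sub.cons {σ : FinTy} (t : Tm σ) (s : Sub) : Sub := fun τ n =>
  if h : τ = σ then
    match n with
    | 0 => h ▸ t
    | k + 1 => s τ k
  else s τ n

/-- Weakening of a term under a quantifier over type `σ`. -/
def Tm.lift (σ : FinTy) {τ : FinTy} (t : Tm τ) : Tm τ := t.subst (Sub.shift σ)

/-- The substitution `s` carried under a quantifier over type `σ`. -/
def Sub.up (σ : FinTy) (s : Sub) : Sub := Sub.cons (.var σ 0) fun τ n => (s τ n).lift σ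

/-- Formulas of many-sorted classical logic; the only prime formulas are equations between terms
of type `0` (and falsum). The other connectives are defined classically below. -/
inductive Fm : Type where
  | bot : Fm
  | eq : Tm ty0 → Tm ty0 → Fm
  | imp : Fm → Fm → Fm
  | all (σ : FinTy) : Fm → Fm

infix:70 " ≐ " => Fm.eq
infixr:40 " ⟶ₘ " => Fm.imp

namespace Fm

def neg (φ : Fm) : Fm := φ ⟶ₘ bot
def and (φ ψ : Fm) : Fm := neg (φ ⟶ₘ neg ψ)
def or (φ ψ : Fm) : Fm := neg φ ⟶ₘ ψ
def iff (φ ψ : Fm) : Fm := and (φ ⟶ₘ ψ) (ψ ⟶ₘ φ)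
def ex (σ : FinTy) (φ : Fm) : Fm := neg (all σ (neg φ))

/-- Capture-avoiding substitution. -/
def subst : Sub → Fm → Fm
  | _, bot => bot
  | s, eq a b => eq (a.subst s) (b.subst s)
  | s, imp φ ψ => imp (φ.subst s) (ψ.subst s)
  | s, all σ φ => all σ (φ.subst (s.up σ))

/-- Weakening of a formula under a quantifier over type `σ`. -/
def lift (σ : FinTy) (φ : Fm) : Fm := φ.subst (Sub.shift σ)

/-- Replace the variable `0` of type `σ` by `t` and lower the others of type `σ` by one. -/
def inst {σ : FinTy} (φ : Fm) (t : Tm σ) : Fm := φ.subst (Sub.cons t Sub.id)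

def QuantifierFree : Fm → Prop
  | bot => True
  | eq _ _ => True
  | imp φ ψ => φ.QuantifierFree ∧ ψ.QuantifierFree
  | all _ _ => False

end Fm

infixr:55 " ⋏ " => Fm.and
infixr:50 " ⋎ " => Fm.or

/-- Equality at type `τ = (τ₁ ⇒ ⋯ ⇒ τₖ ⇒ 0)`, that is `∀ z₁ ⋯ zₖ, s z₁ ⋯ zₖ ≐ t z₁ ⋯ zₖ`. -/
def eqAt : (τ : FinTy) → Tm τ → Tm τ → Fm
  | .zero, s, t => s ≐ t
  | .arrow σ τ, s, t => .all σ (eqAt τ (s.lift σ ⬝ .var σ 0) (t.lift σ ⬝ .var σ 0))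

/-! ## The system `RCA₀^ω` -/

/-- The axioms of `RCA₀^ω`, that is of `E-PRA^ω` together with `QF-AC^{1,0}`. Free variables are
understood as universally quantified (generalisation is available in `Proves`). -/
inductive BaseAx : Fm → Prop
  -- equality of numbers
  | eq_refl : BaseAx (.var ty0 0 ≐ .var ty0 0)
  | eq_eucl : BaseAx (.var ty0 0 ≐ .var ty0 1 ⟶ₘ .var ty0 0 ≐ .var ty0 2 ⟶ₘ
      .var ty0 1 ≐ .var ty0 2)
  -- successor
  | succ_ne_zero : BaseAx (.neg (.succ ⬝ .var ty0 0 ≐ .zero))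
  | succ_inj : BaseAx (.succ ⬝ .var ty0 0 ≐ .succ ⬝ .var ty0 1 ⟶ₘ .var ty0 0 ≐ .var ty0 1)
  -- combinators
  | K_eq (σ τ : FinTy) (x : Tm σ) (y : Tm τ) : BaseAx (eqAt σ (.K σ τ ⬝ x ⬝ y) x)
  | Sc_eq (ρ σ τ : FinTy) (x : Tm (ρ ⇒ σ ⇒ τ)) (y : Tm (ρ ⇒ σ)) (z : Tm ρ) :
      BaseAx (eqAt τ (.Sc ρ σ τ ⬝ x ⬝ y ⬝ z) (x ⬝ z ⬝ (y ⬝ z)))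
  -- recursor of type 0
  | rec0_zero (y : Tm ty0) (z : Tm (ty0 ⇒ ty0 ⇒ ty0)) :
      BaseAx (.rec0 ⬝ .zero ⬝ y ⬝ z ≐ y)
  | rec0_succ (x y : Tm ty0) (z : Tm (ty0 ⇒ ty0 ⇒ ty0)) :
      BaseAx (.rec0 ⬝ (.succ ⬝ x) ⬝ y ⬝ z ≐ z ⬝ (.rec0 ⬝ x ⬝ y ⬝ z) ⬝ x)
  -- extensionality at all types
  | ext (ρ τ : FinTy) (f : Tm (ρ ⇒ τ)) (x y : Tm ρ) :
      BaseAx (eqAt ρ x y ⟶ₘ eqAt τ (f ⬝ x) (f ⬝ y))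
  -- induction for quantifier-free formulas `φ(x)`, where `x` is the variable `0` of type `0`
  | qf_ind (φ : Fm) (hφ : φ.QuantifierFree) :
      BaseAx (φ.inst .zero ⟶ₘ
        .all ty0 (φ ⟶ₘ φ.subst (.cons (.succ ⬝ .var ty0 0) (.shift ty0))) ⟶ₘ .all ty0 φ)
  -- `(∀ f^1 ∃ n^0 φ(f, n)) → ∃ F^2 ∀ f^1 φ(f, F f)` for quantifier-free `φ`, where `f` is the
  -- variable `0` of type `1` and `n` is the variable `0` of type `0`
  | qf_ac (φ : Fm) (hφ : φ.QuantifierFree) :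
      BaseAx (.all ty1 (.ex ty0 φ) ⟶ₘ
        .ex ty2 (.all ty1 (φ.subst (.cons (.var ty2 0 ⬝ .var ty1 0) (.shift ty2)))))

/-- Classical natural deduction from the axioms of `RCA₀^ω`: `Proves Γ φ` says that `φ` is derivable
from the open assumptions `Γ`. -/
inductive Proves : List Fm → Fm → Prop
  | ax {Γ : List Fm} {φ : Fm} : BaseAx φ → Proves Γ φ
  | hyp {Γ : List Fm} {φ : Fm} : φ ∈ Γ → Proves Γ φ
  | imp_intro {Γ : List Fm} {φ ψ : Fm} : Proves (φ :: Γ) ψ → Proves Γ (φ ⟶ₘ ψ)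
  | imp_elim {Γ : List Fm} {φ ψ : Fm} : Proves Γ (φ ⟶ₘ ψ) → Proves Γ φ → Proves Γ ψ
  | by_contra {Γ : List Fm} {φ : Fm} : Proves (φ.neg :: Γ) .bot → Proves Γ φ
  | all_intro {Γ : List Fm} {σ : FinTy} {φ : Fm} :
      Proves (Γ.map (Fm.lift σ)) φ → Proves Γ (.all σ φ)
  | all_elim {Γ : List Fm} {σ : FinTy} {φ : Fm} (t : Tm σ) :
      Proves Γ (.all σ φ) → Proves Γ (φ.inst t)

/-- `φ` is a theorem of `RCA₀^ω`. -/
def RCA0ω (φ : Fm) : Prop := Proves [] φ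

/-! ## Numbers -/

/-- The number `1`. -/
def one : Tm ty0 := .succ ⬝ .zero

/-- For a term `f` of type `1`, the term `λ r i. f r`. -/
def dropSnd (f : Tm ty1) : Tm (ty0 ⇒ ty0 ⇒ ty0) :=
  .Sc ty0 ty0 (ty0 ⇒ ty0) ⬝ (.K (ty0 ⇒ ty0 ⇒ ty0) ty0 ⬝ .K ty0 ty0) ⬝ f

/-- The term `λ r. r + x`. -/
def addFn (x : Tm ty0) : Tm ty1 :=
  .Sc ty0 (ty0 ⇒ ty0 ⇒ ty0) ty0 ⬝ (.rec0 ⬝ x) ⬝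
    (.K (ty0 ⇒ ty0 ⇒ ty0) ty0 ⬝ dropSnd .succ)

/-- The term `x + y`, by recursion on `y`. -/
def add (x y : Tm ty0) : Tm ty0 := .rec0 ⬝ y ⬝ x ⬝ dropSnd .succ

/-- The term `x * y`, by recursion on `y`. -/
def mul (x y : Tm ty0) : Tm ty0 := .rec0 ⬝ y ⬝ .zero ⬝ dropSnd (addFn x)

/-- The code `(x + y)² + x` of the pair `(x, y)`. -/
def pair (x y : Tm ty0) : Tm ty0 := add (mul (add x y) (add x y)) x

/-- `x < y`, that is `∃ z, x + (z + 1) = y`. -/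
def lt (x y : Tm ty0) : Fm := .ex ty0 (add (x.lift ty0) (.succ ⬝ .var ty0 0) ≐ y.lift ty0)

/-! ## The principles -/

/-- The formula in `c` (variable `0` of type `1`) saying that `c` is a colouring of the pairs
`x < y` of natural numbers with the colours `0` and `1`. -/
def twoColouring : Fm :=
  let c : Tm ty1 := .var ty1 0
  .all ty0 (.all ty0 (
    let x : Tm ty0 := .var ty0 1
    let y : Tm ty0 := .var ty0 0
    lt x y ⟶ₘ c ⬝ pair x y ≐ .zero ⋎ c ⬝ pair x y ≐ one))

/-- The formula in `c` (variable `0` of type `1`) saying that `c` is stable: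
`∀ x ∃ i ∃ m ∀ y, x < y → m < y → c(x, y) = i`. -/
def stable : Fm :=
  let c : Tm ty1 := .var ty1 0
  .all ty0 (.ex ty0 (.ex ty0 (.all ty0 (
    let x : Tm ty0 := .var ty0 3
    let i : Tm ty0 := .var ty0 2
    let m : Tm ty0 := .var ty0 1
    let y : Tm ty0 := .var ty0 0
    lt x y ⟶ₘ lt m y ⟶ₘ c ⬝ pair x y ≐ i))))

/-- The formula in `c` (variable `1` of type `1`) and `H` (variable `0` of type `1`) saying that
`H` is (the characteristic function of) an infinite homogeneous set for `c`. -/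
def infiniteHomogeneous : Fm :=
  let c : Tm ty1 := .var ty1 1
  let H : Tm ty1 := .var ty1 0
  -- `H` is binary
  .all ty0 (H ⬝ .var ty0 0 ≐ .zero ⋎ H ⬝ .var ty0 0 ≐ one) ⋏
  -- `H` is infinite: `∀ k ∃ x, k < x ∧ x ∈ H`
  .all ty0 (.ex ty0 (
    let k : Tm ty0 := .var ty0 1
    let x : Tm ty0 := .var ty0 0
    lt k x ⋏ H ⬝ x ≐ one)) ⋏
  -- `H` is homogeneous: `∃ i ∀ x ∀ y, x ∈ H → y ∈ H → x < y → c(x, y) = i`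
  .ex ty0 (.all ty0 (.all ty0 (
    let i : Tm ty0 := .var ty0 2
    let x : Tm ty0 := .var ty0 1
    let y : Tm ty0 := .var ty0 0
    H ⬝ x ≐ one ⟶ₘ H ⬝ y ≐ one ⟶ₘ lt x y ⟶ₘ c ⬝ pair x y ≐ i)))

/-- The formula `USRT²₂(Ψ)` in `Ψ` (variable `0` of type `1 → 1`): for every stable 2-colouring `c`
of pairs, `Ψ(c)` is an infinite homogeneous set for `c`. -/
def usrtBody : Fm :=
  let c : Tm ty1 := .var ty1 0
  let Ψ : Tm ty11 := .var ty11 0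
  .all ty1 (twoColouring ⋏ stable ⟶ₘ infiniteHomogeneous.inst (Ψ ⬝ c))

/-- The formula `USRT²₂(Ψ)` at a term `Ψ`. -/
def usrt (Ψ : Tm ty11) : Fm := usrtBody.inst Ψ

/-- `USRT²₂`. -/
def USRT22 : Fm := .ex ty11 (usrt (.var ty11 0))

/-- The formula `MU(μ)` in `μ` (variable `0` of type `2`):
`∀ f^1, (∃ n, f(n) = 0) → f(μ(f)) = 0`. -/
def muBody : Fm :=
  let f : Tm ty1 := .var ty1 0
  let μ : Tm ty2 := .var ty2 0
  .all ty1 (.ex ty0 (f ⬝ .var ty0 0 ≐ .zero) ⟶ₘ f ⬝ (μ ⬝ f) ≐ .zero)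

/-- The formula `MU(μ)` at a term `μ`. -/
def mu (μ : Tm ty2) : Fm := muBody.inst μ

/-- Feferman's `(μ²)`. -/
def Mu2 : Fm := .ex ty2 (mu (.var ty2 0))

/-- The formula in `Ψ` (variable `1` of type `1 → 1`) and `Θ` (variable `0` of type `1 → 1`) saying
that `Θ` searches the sets that `Ψ` provides: for every stable 2-colouring `c` and every `k`,
`Θ(c)(k)` is an element of `Ψ(c)` above `k`. -/
def searches : Fm :=
  let c : Tm ty1 := .var ty1 0
  let Ψ : Tm ty11 := .var ty11 1
  let Θ : Tm ty11 := .var ty11 0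
  .all ty1 (twoColouring ⋏ stable ⟶ₘ
    .all ty0 (
      let k : Tm ty0 := .var ty0 0
      lt k (Θ ⬝ c ⬝ k) ⋏ Ψ ⬝ c ⬝ (Θ ⬝ c ⬝ k) ≐ one))

end HigherOrderRM

open HigherOrderRM

namespace HigherOrderRM

/-! ## Substitution -/

/-! Derivability is reduced to truth by a Henkin completeness theorem (`RCA0ω.of_sat`): an
underivable sentence fails in the quotient of the terms by provable equality in a complete theory
with witnesses. The extensionality axioms make this quotient an extensional structure, so the rest
is mathematics in an arbitrary extensional model. Its numbers may be nonstandard, and induction is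
available only for quantifier-free formulas with parameters. Closed terms are built by combinatory
abstraction.

From homogeneous sets to `μ`: given `f`, colour the pair coded by `p` with `1` exactly if `f` has a
zero up to `p`. As `y ≤ code x y`, this colouring is stable: constantly `0` without a zero, and
eventually `1` otherwise. Suppose that `f` has a zero and let `x < y` lie in a homogeneous set `H`.
Since `H` is infinite, `x` also forms a pair with an element beyond the zero, so the colour of `H`
is `1`. Hence a bounded search up to `code x y` finds a zero (`IsUsrt.apply_searchT`). The two
elements come from `Θ`, or from two applications of quantifier-free choice when no `Θ` is given.
Once `μ` exists, it also defines `Θ`.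

From `μ` to homogeneous sets: `μ` decides numerical quantifiers (`IsMu.den_forallT`), so it computes
limit colours and moduli of stability. One colour is the limit colour of unboundedly many numbers
(`IsMu.den_colourT`). Enumerate numbers of that limit colour, each above the previous one and above
its modulus; the range is homogeneous, infinite, and decidable by `μ`. With `μ` as a parameter the
inductions needed are again quantifier-free. -/

@[simp] theorem Sub.cons_zero {σ : FinTy} (t : Tm σ) (s : Sub) : Sub.cons t s σ 0 = t := by
  simp [Sub.cons]

@[simp] theorem Sub.cons_succ {σ : FinTy} (t : Tm σ) (s : Sub) (n : ℕ) :
    Sub.cons t s σ (n + 1) = s σ n := by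
  simp [Sub.cons]

theorem Sub.cons_of_ne {σ τ : FinTy} (h : τ ≠ σ) (t : Tm σ) (s : Sub) (n : ℕ) :
    Sub.cons t s τ n = s τ n := by
  simp [Sub.cons, h]

/-- Two substitutions with a case distinction on the type and the index. -/
theorem Sub.ext_at {s s' : Sub} (σ : FinTy) (h0 : s σ 0 = s' σ 0)
    (hs : ∀ n, s σ (n + 1) = s' σ (n + 1)) (hne : ∀ τ, τ ≠ σ → ∀ n, s τ n = s' τ n) : s = s' := by
  funext τ n
  by_cases h : τ = σ
  · subst h
    cases n with
    | zero => exact h0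
    | succ n => exact hs n
  · exact hne τ h n

/-- `s` followed by `s'`. -/
def Sub.comp (s s' : Sub) : Sub := fun σ n => (s σ n).subst s'

theorem Tm.subst_subst (s s' : Sub) {σ : FinTy} (t : Tm σ) :
    (t.subst s).subst s' = t.subst (s.comp s') := by
  induction t <;> simp_all [Tm.subst, Sub.comp]

theorem Tm.subst_id {σ : FinTy} (t : Tm σ) : t.subst Sub.id = t := by
  induction t <;> simp_all [Tm.subst, Sub.id]

theorem Sub.up_zero (σ : FinTy) (s : Sub) : s.up σ σ 0 = .var σ 0 := by simp [Sub.up]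

theorem Sub.up_succ (σ : FinTy) (s : Sub) (n : ℕ) : s.up σ σ (n + 1) = (s σ n).lift σ := by
  simp [Sub.up]

theorem Sub.up_of_ne {σ τ : FinTy} (h : τ ≠ σ) (s : Sub) (n : ℕ) :
    s.up σ τ n = (s τ n).lift σ := by
  simp [Sub.up, Sub.cons_of_ne h]

theorem Sub.shift_comp_cons {σ : FinTy} (t : Tm σ) (s : Sub) :
    (Sub.shift σ).comp (Sub.cons t s) = s := by
  funext τ n
  by_cases h : τ = σ
  · subst h
    simp [Sub.comp, Sub.shift, Tm.subst]
  · simp [Sub.comp, Sub.shift, Tm.subst, h, Sub.cons_of_ne h]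

theorem Sub.shift_comp_up (σ : FinTy) (s : Sub) :
    (Sub.shift σ).comp (s.up σ) = s.comp (Sub.shift σ) :=
  Sub.shift_comp_cons _ _

theorem Tm.lift_subst_up (σ : FinTy) (s : Sub) {τ : FinTy} (t : Tm τ) :
    (t.lift σ).subst (s.up σ) = (t.subst s).lift σ := by
  simp only [Tm.lift, Tm.subst_subst, Sub.shift_comp_up]

theorem Tm.lift_subst_cons {σ : FinTy} (u : Tm σ) (s : Sub) {τ : FinTy} (t : Tm τ) :
    (t.lift σ).subst (Sub.cons u s) = t.subst s := by
  simp only [Tm.lift, Tm.subst_subst, Sub.shift_comp_cons]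

theorem Sub.up_comp_up (σ : FinTy) (s s' : Sub) : (s.up σ).comp (s'.up σ) = (s.comp s').up σ := by
  apply Sub.ext_at σ
  · simp [Sub.comp, Sub.up_zero, Tm.subst]
  · intro n
    simp [Sub.comp, Sub.up_succ, Tm.lift_subst_up]
  · intro τ h n
    simp [Sub.comp, Sub.up_of_ne h, Tm.lift_subst_up]

theorem Sub.up_comp_cons {σ : FinTy} (t : Tm σ) (s s' : Sub) :
    (s.up σ).comp (Sub.cons t s') = Sub.cons t (s.comp s') := by
  apply Sub.ext_at σ
  · simp [Sub.comp, Sub.up_zero, Tm.subst]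
  · intro n
    simp [Sub.comp, Sub.up_succ, Tm.lift_subst_cons]
  · intro τ h n
    simp [Sub.comp, Sub.up_of_ne h, Tm.lift_subst_cons, Sub.cons_of_ne h]

theorem Sub.cons_comp {σ : FinTy} (t : Tm σ) (s s' : Sub) :
    (Sub.cons t s).comp s' = Sub.cons (t.subst s') (s.comp s') := by
  apply Sub.ext_at σ
  · simp [Sub.comp]
  · intro n
    simp [Sub.comp]
  · intro τ h n
    simp [Sub.comp, Sub.cons_of_ne h]

theorem Sub.id_comp (s : Sub) : Sub.id.comp s = s := by
  funext σ n
  simp [Sub.comp, Sub.id, Tm.subst]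

theorem Sub.comp_id (s : Sub) : s.comp Sub.id = s := by
  funext σ n
  simp [Sub.comp, Tm.subst_id]

theorem Sub.up_id (σ : FinTy) : Sub.id.up σ = Sub.id := by
  apply Sub.ext_at σ
  · simp [Sub.up_zero, Sub.id]
  · intro n
    simp [Sub.up_succ, Sub.id, Tm.lift, Tm.subst, Sub.shift]
  · intro τ h n
    simp [Sub.up_of_ne h, Sub.id, Tm.lift, Tm.subst, Sub.shift, h]

theorem Fm.subst_subst (φ : Fm) (s s' : Sub) : (φ.subst s).subst s' = φ.subst (s.comp s') := by
  induction φ generalizing s s' with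
  | bot => rfl
  | eq a b => simp [Fm.subst, Tm.subst_subst]
  | imp φ ψ h1 h2 => simp [Fm.subst, h1, h2]
  | all σ φ h => simp [Fm.subst, h, Sub.up_comp_up]

theorem Fm.subst_id (φ : Fm) : φ.subst Sub.id = φ := by
  induction φ with
  | bot => rfl
  | eq a b => simp [Fm.subst, Tm.subst_id]
  | imp φ ψ h1 h2 => simp [Fm.subst, h1, h2]
  | all σ φ h => simp [Fm.subst, h, Sub.up_id]

theorem Fm.inst_subst {σ : FinTy} (φ : Fm) (t : Tm σ) (s : Sub) :
    (φ.inst t).subst s = (φ.subst (s.up σ)).inst (t.subst s) := by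
  simp [Fm.inst, Fm.subst_subst, Sub.up_comp_cons, Sub.cons_comp, Sub.id_comp, Sub.comp_id]

theorem Fm.subst_up_inst {σ : FinTy} (φ : Fm) (t : Tm σ) (s : Sub) :
    (φ.subst (s.up σ)).inst t = φ.subst (Sub.cons t s) := by
  simp [Fm.inst, Fm.subst_subst, Sub.up_comp_cons, Sub.comp_id]

theorem Fm.lift_subst_up (σ : FinTy) (φ : Fm) (s : Sub) :
    (φ.lift σ).subst (s.up σ) = (φ.subst s).lift σ := by
  simp [Fm.lift, Fm.subst_subst, Sub.shift_comp_up]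

theorem eqAt_subst (τ : FinTy) (a b : Tm τ) (s : Sub) :
    (eqAt τ a b).subst s = eqAt τ (a.subst s) (b.subst s) := by
  induction τ generalizing s with
  | zero => rfl
  | arrow σ τ _ h =>
    simp [eqAt, Fm.subst, h, Tm.subst, Tm.lift_subst_up, Sub.up_zero]

theorem Fm.QuantifierFree.subst {φ : Fm} (h : φ.QuantifierFree) (s : Sub) :
    (φ.subst s).QuantifierFree := by
  induction φ with
  | bot => trivial
  | eq a b => trivial
  | imp φ ψ h1 h2 => exact ⟨h1 h.1, h2 h.2⟩
  | all σ φ _ => exact h.elim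

theorem Tm.lift_comm (σ ρ : FinTy) {τ : FinTy} (t : Tm τ) (h : σ ≠ ρ) :
    (t.lift σ).lift ρ = (t.lift ρ).lift σ := by
  simp only [Tm.lift, Tm.subst_subst]
  congr 1
  funext α n
  simp only [Sub.comp, Sub.shift, Tm.subst]
  split_ifs <;> simp_all

/-! ## Derivability -/

theorem Proves.weaken {Γ Δ : List Fm} {φ : Fm} (h : Proves Γ φ) (hs : Γ ⊆ Δ) : Proves Δ φ := by
  induction h generalizing Δ with
  | ax h => exact .ax h
  | hyp h => exact .hyp (hs h)
  | imp_intro _ ih => exact .imp_intro (ih (List.cons_subset_cons _ hs))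
  | imp_elim _ _ ih1 ih2 => exact .imp_elim (ih1 hs) (ih2 hs)
  | by_contra _ ih => exact .by_contra (ih (List.cons_subset_cons _ hs))
  | all_intro _ ih => exact .all_intro (ih (List.map_subset _ hs))
  | all_elim t _ ih => exact .all_elim t (ih hs)

theorem Proves.all_elim_subst {Γ : List Fm} {σ : FinTy} {φ : Fm} (s : Sub) (t : Tm σ)
    (h : Proves Γ ((Fm.all σ φ).subst s)) : Proves Γ (φ.subst (Sub.cons t s)) := by
  rw [← Fm.subst_up_inst]
  exact .all_elim t h

/-- An axiom holds at any three numbers substituted for its variables `0`, `1`, `2` of type `0`. -/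
theorem BaseAx.proves_cons {Γ : List Fm} {φ : Fm} (h : BaseAx φ) (a b c : Tm ty0) :
    Proves Γ (φ.subst (Sub.cons a (Sub.cons b (Sub.cons c Sub.id)))) := by
  have h3 : Proves Γ ((Fm.all ty0 (.all ty0 (.all ty0 φ))).subst Sub.id) := by
    rw [Fm.subst_id]
    exact .all_intro (.all_intro (.all_intro (.ax h)))
  exact .all_elim_subst _ _ (.all_elim_subst _ _ (.all_elim_subst _ _ h3))

theorem Sub.up_comp_cons_shift (σ : FinTy) (t : Tm σ) (s : Sub) (ht : t.subst (s.up σ) = t) :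
    (Sub.cons t (Sub.shift σ)).comp (s.up σ) = (s.up σ).comp (Sub.cons t (Sub.shift σ)) := by
  rw [Sub.cons_comp, ht, Sub.shift_comp_up, Sub.up_comp_cons]

/-- Lets a substitution pass through the choice axiom, whose conclusion replaces the number variable
by the new functional applied to its argument. -/
theorem Sub.choice_comp_up_up (s : Sub) :
    (Sub.cons (.var ty2 0 ⬝ .var ty1 0) (.shift ty2)).comp ((s.up ty2).up ty1) =
      ((s.up ty1).up ty0).comp (Sub.cons (.var ty2 0 ⬝ .var ty1 0) (.shift ty2)) := by
  rw [Sub.up_comp_cons, Sub.cons_comp]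
  congr 1
  · apply Sub.ext_at ty1
    · simp [Sub.comp, Sub.shift, Tm.subst, Sub.up_zero]
    · intro n
      have := (s ty1 n).lift_comm ty2 ty1 (by simp)
      simp [Sub.comp, Sub.shift, Tm.subst, Sub.up_succ, Sub.up_of_ne]
      exact this
    · intro τ h n
      by_cases h2 : τ = ty2
      · subst h2
        have := (s ty2 n).lift_comm ty2 ty1 (by simp)
        simp [Sub.comp, Sub.shift, Tm.subst, Sub.up_succ, Sub.up_of_ne]
        exact this
      · have := (s τ n).lift_comm ty2 ty1 (by simp)
        simp [Sub.comp, Sub.shift, Tm.subst, Sub.up_of_ne, h, h2]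
        exact this

/-- The schemata are closed under substitution, each instance going to another instance. The
equality and successor axioms are stated for fixed variables, so they are generalised and then
instantiated. -/
theorem BaseAx.proves_subst {Γ : List Fm} {φ : Fm} (h : BaseAx φ) (s : Sub) :
    Proves Γ (φ.subst s) := by
  cases h with
  | eq_refl =>
    simpa [Fm.subst, Tm.subst] using BaseAx.eq_refl.proves_cons (Γ := Γ) (s ty0 0) .zero .zero
  | eq_eucl =>
    have := BaseAx.eq_eucl.proves_cons (Γ := Γ) (s ty0 0) (s ty0 1) (s ty0 2)
    have h1 (a b c : Tm ty0) : Sub.cons a (Sub.cons b (Sub.cons c Sub.id)) ty0 1 = b := rfl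
    have h2 (a b c : Tm ty0) : Sub.cons a (Sub.cons b (Sub.cons c Sub.id)) ty0 2 = c := rfl
    simpa [Fm.subst, Tm.subst, h1, h2] using this
  | succ_ne_zero =>
    simpa [Fm.subst, Tm.subst, Fm.neg] using
      BaseAx.succ_ne_zero.proves_cons (Γ := Γ) (s ty0 0) .zero .zero
  | succ_inj =>
    have := BaseAx.succ_inj.proves_cons (Γ := Γ) (s ty0 0) (s ty0 1) .zero
    have h1 (a b c : Tm ty0) : Sub.cons a (Sub.cons b (Sub.cons c Sub.id)) ty0 1 = b := rfl
    simpa [Fm.subst, Tm.subst, h1] using this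
  | K_eq σ τ x y =>
    rw [eqAt_subst]
    exact .ax (.K_eq ..)
  | Sc_eq ρ σ τ x y z =>
    rw [eqAt_subst]
    exact .ax (.Sc_eq ..)
  | rec0_zero y z => exact .ax (.rec0_zero ..)
  | rec0_succ x y z => exact .ax (.rec0_succ ..)
  | ext ρ τ f x y =>
    simp only [Fm.subst, eqAt_subst]
    exact .ax (.ext ..)
  | qf_ind φ hφ =>
    have := Sub.up_comp_cons_shift ty0 (.succ ⬝ .var ty0 0) s (by simp [Tm.subst, Sub.up_zero])
    simp only [Fm.subst, Fm.inst_subst, Fm.subst_subst, this]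
    rw [← Fm.subst_subst]
    exact .ax (.qf_ind _ (hφ.subst _))
  | qf_ac φ hφ =>
    simp only [Fm.subst, Fm.ex, Fm.neg, Fm.subst_subst, Sub.choice_comp_up_up]
    rw [← Fm.subst_subst]
    exact .ax (.qf_ac _ (hφ.subst _))

theorem Proves.subst {Γ : List Fm} {φ : Fm} (h : Proves Γ φ) (s : Sub) :
    Proves (Γ.map (Fm.subst s)) (φ.subst s) := by
  induction h generalizing s with
  | ax h => exact h.proves_subst s
  | hyp h => exact .hyp (List.mem_map_of_mem h)
  | imp_intro _ ih => exact .imp_intro (ih s)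
  | imp_elim _ _ ih1 ih2 => exact .imp_elim (ih1 s) (ih2 s)
  | by_contra _ ih => exact .by_contra (ih s)
  | @all_intro Γ σ φ _ ih =>
    refine .all_intro ?_
    have := ih (s.up σ)
    simpa only [List.map_map, Function.comp_def, Fm.lift_subst_up] using this
  | all_elim t _ ih =>
    rw [Fm.inst_subst]
    exact .all_elim _ (ih s)

/-! ## Fresh variables -/

/-- The free variables of `φ` have indices below `N`. -/
def Fm.Below (N : ℕ) (φ : Fm) : Prop :=
  ∀ s s' : Sub, (∀ σ, ∀ n < N, s σ n = s' σ n) → φ.subst s = φ.subst s'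

theorem Fm.Below.mono {N N' : ℕ} {φ : Fm} (h : φ.Below N) (hN : N ≤ N') : φ.Below N' :=
  fun s s' hs => h s s' fun σ n hn => hs σ n (hn.trans_le hN)

theorem Tm.exists_below {σ : FinTy} (t : Tm σ) :
    ∃ N, ∀ s s' : Sub, (∀ σ, ∀ n < N, s σ n = s' σ n) → t.subst s = t.subst s' := by
  induction t with
  | var σ n => exact ⟨n + 1, fun s s' h => h σ n (Nat.lt_succ_self n)⟩
  | app f x hf hx =>
    obtain ⟨N, hN⟩ := hf
    obtain ⟨N', hN'⟩ := hx
    refine ⟨max N N', fun s s' h => ?_⟩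
    simp only [Tm.subst]
    rw [hN s s' fun σ n hn => h σ n (lt_max_of_lt_left hn),
      hN' s s' fun σ n hn => h σ n (lt_max_of_lt_right hn)]
  | _ => exact ⟨0, fun _ _ _ => rfl⟩

theorem Fm.exists_below (φ : Fm) : ∃ N, φ.Below N := by
  induction φ with
  | bot => exact ⟨0, fun _ _ _ => rfl⟩
  | eq a b =>
    obtain ⟨N, hN⟩ := a.exists_below
    obtain ⟨N', hN'⟩ := b.exists_below
    refine ⟨max N N', fun s s' h => ?_⟩
    simp only [Fm.subst]
    rw [hN s s' fun σ n hn => h σ n (lt_max_of_lt_left hn),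
      hN' s s' fun σ n hn => h σ n (lt_max_of_lt_right hn)]
  | imp φ ψ h1 h2 =>
    obtain ⟨N, hN⟩ := h1
    obtain ⟨N', hN'⟩ := h2
    refine ⟨max N N', fun s s' h => ?_⟩
    simp only [Fm.subst]
    rw [hN s s' fun σ n hn => h σ n (lt_max_of_lt_left hn),
      hN' s s' fun σ n hn => h σ n (lt_max_of_lt_right hn)]
  | all σ φ h =>
    obtain ⟨N, hN⟩ := h
    refine ⟨N, fun s s' h => ?_⟩
    simp only [Fm.subst]
    rw [hN (s.up σ) (s'.up σ) fun τ n hn => ?_]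
    by_cases hτ : τ = σ
    · subst hτ
      cases n with
      | zero => simp [Sub.up_zero]
      | succ n => rw [Sub.up_succ, Sub.up_succ, h _ n (by omega)]
    · rw [Sub.up_of_ne hτ, Sub.up_of_ne hτ, h τ n hn]

theorem exists_below_list (Γ : List Fm) : ∃ N, ∀ φ ∈ Γ, φ.Below N := by
  induction Γ with
  | nil => exact ⟨0, by simp⟩
  | cons φ Γ ih =>
    obtain ⟨N, hN⟩ := ih
    obtain ⟨N', hN'⟩ := φ.exists_below
    refine ⟨max N N', fun ψ hψ => ?_⟩
    rcases List.mem_cons.1 hψ with rfl | h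
    · exact hN'.mono (le_max_right _ _)
    · exact (hN ψ h).mono (le_max_left _ _)

/-- Generalisation over a fresh variable. -/
theorem Proves.all_of_fresh {Γ : List Fm} {σ : FinTy} {φ : Fm} {N : ℕ} (hΓ : ∀ ψ ∈ Γ, ψ.Below N)
    (hφ : φ.Below N) (h : Proves Γ (φ.inst (.var σ N))) : Proves Γ (.all σ φ) := by
  -- This undoes the instantiation: the fresh variable becomes the bound variable `0`, and every
  -- other variable is shifted out of its way.
  let s : Sub := fun τ n => if τ = σ ∧ n = N then .var τ 0 else Sub.shift σ τ n
  have hs : s σ N = .var σ 0 := by simp [s]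
  have hs' (τ : FinTy) (n : ℕ) (hn : n < N) : s τ n = Sub.shift σ τ n := by
    simp [s, hn.ne]
  have key := h.subst s
  have h1 : Γ.map (Fm.subst s) = Γ.map (Fm.lift σ) :=
    List.map_congr_left fun ψ hψ => hΓ ψ hψ _ _ hs'
  have h2 : (φ.inst (.var σ N)).subst s = φ := by
    rw [Fm.inst, Fm.subst_subst, Sub.cons_comp, Sub.id_comp]
    conv_rhs => rw [← φ.subst_id]
    refine hφ _ _ fun τ n hn => ?_
    by_cases hτ : τ = σ
    · subst hτ
      cases n with
      | zero => simp [Tm.subst, hs, Sub.id]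
      | succ n => simp [hs' τ n (by omega), Sub.shift, Sub.id]
    · rw [Sub.cons_of_ne hτ, hs' τ n hn]
      simp [Sub.shift, hτ, Sub.id]
  rw [h1, h2] at key
  exact .all_intro key

/-! ## The language is countable -/

def FinTy.code : FinTy → ℕ
  | .zero => 0
  | .arrow σ τ => Nat.pair σ.code τ.code + 1

theorem FinTy.code_injective : Function.Injective FinTy.code := by
  intro σ τ h
  induction σ generalizing τ with
  | zero => cases τ <;> simp_all [FinTy.code]
  | arrow a b ha hb =>
    cases τ with
    | zero => simp [FinTy.code] at h
    | arrow c d =>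
      simp only [FinTy.code, Nat.add_right_cancel_iff, Nat.pair_eq_pair] at h
      rw [ha h.1, hb h.2]

def Tm.code : {σ : FinTy} → Tm σ → ℕ
  | _, .var σ n => Nat.pair 0 (Nat.pair σ.code n)
  | _, .app f x => Nat.pair 1 (Nat.pair f.code x.code)
  | _, .zero => Nat.pair 2 0
  | _, .succ => Nat.pair 3 0
  | _, .K σ τ => Nat.pair 4 (Nat.pair σ.code τ.code)
  | _, .Sc ρ σ τ => Nat.pair 5 (Nat.pair ρ.code (Nat.pair σ.code τ.code))
  | _, .rec0 => Nat.pair 6 0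

/-- The types must be allowed to differ, because the type of an application does not determine the
type of its argument. -/
theorem Tm.code_injective {σ τ : FinTy} (t : Tm σ) (u : Tm τ) (h : t.code = u.code) :
    σ = τ ∧ HEq t u := by
  induction t generalizing τ with
  | var σ n =>
    cases u <;> simp [Tm.code, FinTy.code_injective.eq_iff] at h
    obtain ⟨rfl, rfl⟩ := h
    exact ⟨rfl, HEq.rfl⟩
  | app f x hf hx =>
    cases u <;> simp [Tm.code] at h
    obtain ⟨h1, h2⟩ := hf _ h.1
    obtain ⟨rfl, h4⟩ := hx _ h.2
    cases h1
    cases h2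
    cases h4
    exact ⟨rfl, HEq.rfl⟩
  | zero =>
    cases u <;> simp [Tm.code] at h
    exact ⟨rfl, HEq.rfl⟩
  | succ =>
    cases u <;> simp [Tm.code] at h
    exact ⟨rfl, HEq.rfl⟩
  | rec0 =>
    cases u <;> simp [Tm.code] at h
    exact ⟨rfl, HEq.rfl⟩
  | K σ τ =>
    cases u <;> simp [Tm.code, FinTy.code_injective.eq_iff] at h
    obtain ⟨rfl, rfl⟩ := h
    exact ⟨rfl, HEq.rfl⟩
  | Sc ρ σ τ =>
    cases u <;> simp [Tm.code, FinTy.code_injective.eq_iff] at h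
    obtain ⟨rfl, rfl, rfl⟩ := h
    exact ⟨rfl, HEq.rfl⟩

def Fm.code : Fm → ℕ
  | .bot => Nat.pair 0 0
  | .eq a b => Nat.pair 1 (Nat.pair a.code b.code)
  | .imp φ ψ => Nat.pair 2 (Nat.pair φ.code ψ.code)
  | .all σ φ => Nat.pair 3 (Nat.pair σ.code φ.code)

theorem Fm.code_injective : Function.Injective Fm.code := by
  intro φ ψ h
  induction φ generalizing ψ with
  | bot => cases ψ <;> simp [Fm.code] at h ⊢
  | eq a b =>
    cases ψ <;> simp [Fm.code] at h
    rw [eq_of_heq (Tm.code_injective _ _ h.1).2, eq_of_heq (Tm.code_injective _ _ h.2).2]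
  | imp φ ψ h1 h2 =>
    cases ψ <;> simp [Fm.code] at h
    rw [h1 h.1, h2 h.2]
  | all σ φ ih =>
    cases ψ <;> simp [Fm.code, FinTy.code_injective.eq_iff] at h
    rw [h.1, ih h.2]

instance : Countable Fm := Fm.code_injective.countable

/-! ## Henkin sets -/

/-- `Γ` is consistent. -/
def Con (Γ : List Fm) : Prop := ¬ Proves Γ .bot

theorem Proves.cut {Γ : List Fm} {φ ψ : Fm} (h1 : Proves (φ :: Γ) ψ) (h2 : Proves Γ φ) :
    Proves Γ ψ :=
  .imp_elim (.imp_intro h1) h2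

theorem Proves.exfalso {Γ : List Fm} (φ : Fm) (h : Proves Γ .bot) : Proves Γ φ :=
  .by_contra (h.weaken (List.subset_cons_self _ _))

/-- One stage of the Henkin construction. A stage is a finite list, so some variable is fresh for it
and can serve as the witness; no new constants are added to the language. -/
theorem Con.exists_witness {Γ : List Fm} (hΓ : Con Γ) (ψ : Fm) :
    ∃ Δ, Con Δ ∧ Γ ⊆ Δ ∧ (ψ ∈ Δ ∨ ¬ Con (ψ :: Γ)) ∧
      ∀ σ θ, ψ = Fm.neg (.all σ θ) → ψ ∈ Δ → ∃ t : Tm σ, (θ.inst t).neg ∈ Δ := by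
  by_cases hψ : Con (ψ :: Γ)
  · by_cases hw : ∃ σ θ, ψ = Fm.neg (.all σ θ)
    · obtain ⟨σ, θ, rfl⟩ := hw
      obtain ⟨N, hN⟩ := exists_below_list (θ :: Fm.neg (.all σ θ) :: Γ)
      refine ⟨(θ.inst (.var σ N)).neg :: Fm.neg (.all σ θ) :: Γ, fun h => hψ ?_,
        fun φ h => by simp [h], .inl (by simp), ?_⟩
      · have h1 : Proves (Fm.neg (.all σ θ) :: Γ) (.all σ θ) :=
          Proves.all_of_fresh (fun φ h => hN φ (List.mem_cons_of_mem _ h)) (hN θ (by simp))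
            (.by_contra h)
        exact .imp_elim (.hyp (by simp [Fm.neg])) h1
      · rintro σ' θ' h -
        simp only [Fm.neg, Fm.imp.injEq, Fm.all.injEq] at h
        obtain ⟨⟨rfl, rfl⟩, -⟩ := h
        exact ⟨.var σ N, by simp⟩
    · exact ⟨ψ :: Γ, hψ, List.subset_cons_self _ _, .inl (by simp),
        fun σ θ h => (hw ⟨σ, θ, h⟩).elim⟩
  -- A rejected formula cannot already belong to the list, so no witness is owed for it.
  · refine ⟨Γ, hΓ, List.Subset.refl _, .inr hψ, fun σ θ h hm => (hψ fun h' => hΓ ?_).elim⟩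
    exact h'.cut (.hyp hm)

/-- A complete theory with witnesses. -/
structure IsHenkin (T : Set Fm) : Prop where
  proves : ∀ φ, Proves [] φ → φ ∈ T
  bot : Fm.bot ∉ T
  imp : ∀ φ ψ, (φ ⟶ₘ ψ) ∈ T ↔ (φ ∈ T → ψ ∈ T)
  all : ∀ σ φ, Fm.all σ φ ∈ T ↔ ∀ t : Tm σ, φ.inst t ∈ T

/-- Decide the formulas one by one along an enumeration and take the union of the stages. A
derivation from one stage is compared with a decision at another in the later of the two. -/
theorem Con.exists_isHenkin {Γ : List Fm} (hΓ : Con Γ) :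
    ∃ T : Set Fm, IsHenkin T ∧ ∀ φ ∈ Γ, φ ∈ T := by
  have : Nonempty Fm := ⟨.bot⟩
  obtain ⟨e, he⟩ := exists_surjective_nat Fm
  choose next hcon hsub hdec hwit using
    fun (Γ : {Γ : List Fm // Con Γ}) (ψ : Fm) => Γ.2.exists_witness ψ
  let L : ℕ → {Γ : List Fm // Con Γ} :=
    fun n => n.rec ⟨Γ, hΓ⟩ fun n Δ => ⟨next Δ (e n), hcon Δ (e n)⟩
  have hL (n : ℕ) : (L (n + 1)).1 = next (L n) (e n) := rfl
  have hmono : ∀ {m n : ℕ}, m ≤ n → (L m).1 ⊆ (L n).1 := by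
    intro m n h
    induction h with
    | refl => exact List.Subset.refl _
    | step _ ih => exact fun _ h => hsub _ _ (ih h)
  have hclosed : ∀ (n : ℕ) (φ : Fm), Proves (L n).1 φ → ∃ m, φ ∈ (L m).1 := by
    intro n φ h
    obtain ⟨k, rfl⟩ := he φ
    rcases hdec (L k) (e k) with h1 | h1
    · exact ⟨k + 1, h1⟩
    · have h2 : Proves (L k).1 (e k).neg := .imp_intro (not_not.1 h1)
      exact ((L (max k n)).2 (.imp_elim (h2.weaken (hmono (le_max_left _ _)))
        (h.weaken (hmono (le_max_right _ _))))).elim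
  have hneg : ∀ φ : Fm, (∃ m, φ ∈ (L m).1) ∨ ∃ m, φ.neg ∈ (L m).1 := by
    intro φ
    obtain ⟨k, rfl⟩ := he φ
    rcases hdec (L k) (e k) with h1 | h1
    · exact .inl ⟨k + 1, h1⟩
    · exact .inr (hclosed k _ (.imp_intro (not_not.1 h1)))
  have hmp : ∀ {φ ψ : Fm} {m n : ℕ}, (φ ⟶ₘ ψ) ∈ (L m).1 → φ ∈ (L n).1 →
      Proves (L (max m n)).1 ψ := fun h1 h2 =>
    .imp_elim (.hyp (hmono (le_max_left _ _) h1)) (.hyp (hmono (le_max_right _ _) h2))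
  refine ⟨{φ | ∃ n, φ ∈ (L n).1}, ⟨?_, ?_, ?_, ?_⟩, fun φ h => ⟨0, h⟩⟩
  · exact fun φ h => hclosed 0 φ (h.weaken (List.nil_subset _))
  · rintro ⟨n, h⟩
    exact (L n).2 (.hyp h)
  · refine fun φ ψ => ⟨fun ⟨m, h1⟩ ⟨n, h2⟩ => hclosed _ _ (hmp h1 h2), fun h => ?_⟩
    rcases hneg φ with h1 | ⟨m, h1⟩
    · obtain ⟨n, h2⟩ := h h1
      exact hclosed n _ (.imp_intro (.hyp (List.mem_cons_of_mem _ h2)))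
    · exact hclosed m _ (.imp_intro (.exfalso _ (.imp_elim (φ := φ)
        (.hyp (List.mem_cons_of_mem _ h1)) (.hyp (by simp)))))
  · refine fun σ φ => ⟨fun ⟨n, h⟩ t => hclosed n _ (.all_elim t (.hyp h)), fun h => ?_⟩
    rcases hneg (.all σ φ) with h1 | ⟨m, h1⟩
    · exact h1
    -- The witness was added when the negated universal formula was itself decided. That decision
    -- was positive, since a rejection would contradict its membership in a later stage.
    · obtain ⟨k, hk⟩ := he (Fm.neg (.all σ φ))
      have h2 : e k ∈ (L (k + 1)).1 := by
        rcases hdec (L k) (e k) with h2 | h2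
        · exact h2
        · rw [hk] at h2
          exact ((L (max k m)).2 (Proves.cut ((not_not.1 h2).weaken
            (List.cons_subset_cons _ (hmono (le_max_left _ _))))
            (.hyp (hmono (le_max_right _ _) h1)))).elim
      obtain ⟨t, ht⟩ := hwit (L k) (e k) σ φ hk h2
      obtain ⟨n, hn⟩ := h t
      exact ((L _).2 (hmp (m := k + 1) ht hn)).elim

/-! ## Structures -/

/-- Extensional applicative structures for the language. -/
structure Str where
  C : FinTy → Type
  app : {σ τ : FinTy} → C (σ ⇒ τ) → C σ → C τ
  zero : C ty0
  succ : C (ty0 ⇒ ty0)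
  K (σ τ : FinTy) : C (σ ⇒ τ ⇒ σ)
  Sc (ρ σ τ : FinTy) : C ((ρ ⇒ σ ⇒ τ) ⇒ (ρ ⇒ σ) ⇒ ρ ⇒ τ)
  rec0 : C (ty0 ⇒ ty0 ⇒ (ty0 ⇒ ty0 ⇒ ty0) ⇒ ty0)
  ext : ∀ {σ τ : FinTy} (f g : C (σ ⇒ τ)), (∀ x, app f x = app g x) → f = g

/-- Assignments of values to the variables. -/
abbrev Str.Val (M : Str) : Type := (σ : FinTy) → ℕ → M.C σ

namespace Str

variable {M : Str}

/-- The value of a term. -/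
def eval (v : M.Val) : {σ : FinTy} → Tm σ → M.C σ
  | _, .var σ n => v σ n
  | _, .app f x => M.app (eval v f) (eval v x)
  | _, .zero => M.zero
  | _, .succ => M.succ
  | _, .K σ τ => M.K σ τ
  | _, .Sc ρ σ τ => M.Sc ρ σ τ
  | _, .rec0 => M.rec0

/-- The value of variable `0` of type `σ` becomes `a`, the others of type `σ` move up. -/
def Val.cons {σ : FinTy} (a : M.C σ) (v : M.Val) : M.Val := fun τ n =>
  if h : τ = σ then
    match n with
    | 0 => h ▸ a
    | k + 1 => v τ k
  else v τ n

@[simp] theorem Val.cons_zero {σ : FinTy} (a : M.C σ) (v : M.Val) : Val.cons a v σ 0 = a := by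
  simp [Val.cons]

@[simp] theorem Val.cons_succ {σ : FinTy} (a : M.C σ) (v : M.Val) (n : ℕ) :
    Val.cons a v σ (n + 1) = v σ n := by
  simp [Val.cons]

theorem Val.cons_of_ne {σ τ : FinTy} (h : τ ≠ σ) (a : M.C σ) (v : M.Val) (n : ℕ) :
    Val.cons a v τ n = v τ n := by
  simp [Val.cons, h]

theorem Val.ext_at {v v' : M.Val} (σ : FinTy) (h0 : v σ 0 = v' σ 0)
    (hs : ∀ n, v σ (n + 1) = v' σ (n + 1)) (hne : ∀ τ, τ ≠ σ → ∀ n, v τ n = v' τ n) : v = v' := by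
  funext τ n
  by_cases h : τ = σ
  · subst h
    cases n with
    | zero => exact h0
    | succ n => exact hs n
  · exact hne τ h n

/-- Truth of a formula. -/
def Sat : M.Val → Fm → Prop
  | _, .bot => False
  | v, .eq a b => eval v a = eval v b
  | v, .imp φ ψ => Sat v φ → Sat v ψ
  | v, .all σ φ => ∀ a : M.C σ, Sat (Val.cons a v) φ

/-- The assignment `n ↦ s(n)` evaluated under `v`. -/
def Val.sub (v : M.Val) (s : Sub) : M.Val := fun σ n => eval v (s σ n)

theorem eval_subst (v : M.Val) (s : Sub) {σ : FinTy} (t : Tm σ) :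
    eval v (t.subst s) = eval (v.sub s) t := by
  induction t <;> simp_all [Tm.subst, eval, Val.sub]

@[simp] theorem Val.cons_sub_shift {σ : FinTy} (a : M.C σ) (v : M.Val) :
    (v.cons a).sub (.shift σ) = v := by
  funext τ n
  by_cases h : τ = σ
  · subst h
    simp [Val.sub, Sub.shift, eval]
  · simp [Val.sub, Sub.shift, eval, h, Val.cons_of_ne]

@[simp] theorem eval_lift {σ τ : FinTy} (a : M.C σ) (v : M.Val) (t : Tm τ) :
    eval (v.cons a) (t.lift σ) = eval v t := by
  simp [Tm.lift, eval_subst]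

theorem Val.sub_cons {σ : FinTy} (v : M.Val) (t : Tm σ) (s : Sub) :
    v.sub (.cons t s) = (v.sub s).cons (eval v t) := by
  apply Val.ext_at σ
  · simp [Val.sub]
  · simp [Val.sub]
  · intro τ h n
    simp [Val.sub, Sub.cons_of_ne h, Val.cons_of_ne h]

theorem Val.cons_sub_up {σ : FinTy} (a : M.C σ) (v : M.Val) (s : Sub) :
    (v.cons a).sub (s.up σ) = (v.sub s).cons a := by
  rw [Sub.up, Val.sub_cons]
  congr 1
  · simp [eval]
  · funext τ n
    simp [Val.sub]

theorem sat_subst (v : M.Val) (s : Sub) (φ : Fm) : Sat v (φ.subst s) ↔ Sat (v.sub s) φ := by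
  induction φ generalizing v s with
  | bot => rfl
  | eq a b => simp [Fm.subst, Sat, eval_subst]
  | imp φ ψ h1 h2 => simp [Fm.subst, Sat, h1, h2]
  | all σ φ h => simp [Fm.subst, Sat, h, Val.cons_sub_up]

theorem sat_inst {σ : FinTy} (v : M.Val) (t : Tm σ) (φ : Fm) :
    Sat v (φ.inst t) ↔ Sat (v.cons (eval v t)) φ := by
  rw [Fm.inst, sat_subst, Val.sub_cons]
  rfl

/-- Extensionality of the structure makes the defined equality at higher types coincide with
identity. -/
theorem sat_eqAt (v : M.Val) (τ : FinTy) (a b : Tm τ) :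
    Sat v (eqAt τ a b) ↔ eval v a = eval v b := by
  induction τ generalizing v with
  | zero => rfl
  | arrow σ τ _ h =>
    simp only [eqAt, Sat, h, eval, eval_lift, Val.cons_zero]
    exact ⟨M.ext _ _, fun h x => by rw [h]⟩

end Str

/-- Extensional models of `RCA₀^ω`. -/
structure Model extends Str where
  sat_ax : ∀ φ, BaseAx φ → ∀ v : toStr.Val, Str.Sat v φ

/-! ## The term model -/

namespace IsHenkin

variable {T : Set Fm}

theorem mp (hT : IsHenkin T) {φ ψ : Fm} (h : (φ ⟶ₘ ψ) ∈ T) (h1 : φ ∈ T) : ψ ∈ T := (hT.imp _ _).1 h h1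

theorem proves_subst (hT : IsHenkin T) {φ : Fm} (h : BaseAx φ) (s : Sub) : φ.subst s ∈ T :=
  hT.proves _ (h.proves_subst s)

/-- In a Henkin theory a universal formula amounts to all its term instances. -/
theorem eqAt_arrow (hT : IsHenkin T) {σ τ : FinTy} {f g : Tm (σ ⇒ τ)} :
    eqAt (σ ⇒ τ) f g ∈ T ↔ ∀ t, eqAt τ (f ⬝ t) (g ⬝ t) ∈ T := by
  simp [eqAt, hT.all, Fm.inst, eqAt_subst, Tm.subst, Tm.lift_subst_cons, Tm.subst_id]

theorem eqAt_refl (hT : IsHenkin T) {τ : FinTy} (a : Tm τ) : eqAt τ a a ∈ T := by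
  induction τ with
  | zero =>
    exact hT.proves_subst .eq_refl (Sub.cons a Sub.id)
  | arrow σ τ _ h => exact hT.eqAt_arrow.2 fun t => h _

theorem eqAt_eucl (hT : IsHenkin T) {τ : FinTy} {a b c : Tm τ} (h1 : eqAt τ a b ∈ T) (h2 : eqAt τ a c ∈ T) :
    eqAt τ b c ∈ T := by
  induction τ with
  | zero =>
    have := hT.proves_subst .eq_eucl (Sub.cons a (Sub.cons b (Sub.cons c Sub.id)))
    exact hT.mp (hT.mp this h1) h2
  | arrow σ τ _ h =>
    rw [hT.eqAt_arrow] at *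
    exact fun t => h (h1 t) (h2 t)

theorem eqAt_symm (hT : IsHenkin T) {τ : FinTy} {a b : Tm τ} (h : eqAt τ a b ∈ T) : eqAt τ b a ∈ T :=
  hT.eqAt_eucl h (hT.eqAt_refl a)

theorem eqAt_trans (hT : IsHenkin T) {τ : FinTy} {a b c : Tm τ} (h1 : eqAt τ a b ∈ T) (h2 : eqAt τ b c ∈ T) :
    eqAt τ a c ∈ T :=
  hT.eqAt_eucl (hT.eqAt_symm h1) h2

/-- The extensionality axiom changes the argument, and the definition of equality at arrow types
changes the function. This makes application well defined on classes. -/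
theorem eqAt_app (hT : IsHenkin T) {σ τ : FinTy} {f g : Tm (σ ⇒ τ)} {x y : Tm σ} (h1 : eqAt (σ ⇒ τ) f g ∈ T)
    (h2 : eqAt σ x y ∈ T) : eqAt τ (f ⬝ x) (g ⬝ y) ∈ T :=
  hT.eqAt_trans (hT.mp (hT.proves _ (.ax (.ext σ τ f x y))) h2) (hT.eqAt_arrow.1 h1 y)

/-- Equality of terms according to `T`. -/
def setoid (hT : IsHenkin T) (σ : FinTy) : Setoid (Tm σ) where
  r a b := eqAt σ a b ∈ T
  iseqv := ⟨hT.eqAt_refl, hT.eqAt_symm, hT.eqAt_trans⟩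

/-- The structure of terms up to equality according to `T`. -/
def str (hT : IsHenkin T) : Str where
  C σ := Quotient (hT.setoid σ)
  app := Quotient.map₂ Tm.app fun _ _ h1 _ _ h2 => hT.eqAt_app h1 h2
  zero := ⟦.zero⟧
  succ := ⟦.succ⟧
  K σ τ := ⟦.K σ τ⟧
  Sc ρ σ τ := ⟦.Sc ρ σ τ⟧
  rec0 := ⟦.rec0⟧
  ext f g := by
    induction f using Quotient.inductionOn
    induction g using Quotient.inductionOn
    exact fun h => Quotient.sound (hT.eqAt_arrow.2 fun t => Quotient.exact (h ⟦t⟧))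

/-- The class of a term. -/
def cls (hT : IsHenkin T) {σ : FinTy} (t : Tm σ) : hT.str.C σ := Quotient.mk (hT.setoid σ) t

theorem cls_eq_cls (hT : IsHenkin T) {σ : FinTy} {t u : Tm σ} :
    hT.cls t = hT.cls u ↔ eqAt σ t u ∈ T :=
  ⟨Quotient.exact, Quotient.sound (s := hT.setoid σ)⟩

theorem cls_surjective (hT : IsHenkin T) {σ : FinTy} (a : hT.str.C σ) : ∃ t, hT.cls t = a :=
  Quotient.exists_rep a

/-- The assignment given by a substitution. -/
def val (hT : IsHenkin T) (s : Sub) : hT.str.Val := fun σ n => hT.cls (s σ n)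

theorem eval_val (hT : IsHenkin T) (s : Sub) {σ : FinTy} (t : Tm σ) :
    Str.eval (hT.val s) t = hT.cls (t.subst s) := by
  induction t with
  | app f x hf hx =>
    rw [Str.eval, hf, hx]
    rfl
  | _ => rfl

theorem val_cons (hT : IsHenkin T) {σ : FinTy} (t : Tm σ) (s : Sub) :
    (hT.val s).cons (hT.cls t) = hT.val (.cons t s) := by
  apply Str.Val.ext_at σ
  · simp [val]
  · simp [val]
  · intro τ h n
    simp [val, Sub.cons_of_ne h, Str.Val.cons_of_ne h]

/-- The truth lemma. In the quantifier case every element of the quotient is the class of a term. -/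
theorem sat_val (hT : IsHenkin T) (s : Sub) (φ : Fm) :
    Str.Sat (hT.val s) φ ↔ φ.subst s ∈ T := by
  induction φ generalizing s with
  | bot => simp [Str.Sat, Fm.subst, hT.bot]
  | eq a b =>
    simp only [Str.Sat, Fm.subst, eval_val, cls_eq_cls]
    rfl
  | imp φ ψ h1 h2 => simp [Str.Sat, Fm.subst, h1, h2, hT.imp]
  | all σ φ h =>
    simp only [Str.Sat, Fm.subst, hT.all, Fm.subst_up_inst, ← h, ← val_cons]
    refine ⟨fun h t => h _, fun h a => ?_⟩
    obtain ⟨t, rfl⟩ := hT.cls_surjective a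
    exact h t

/-- Hence validity of an axiom under all assignments reduces to its closure under substitution. -/
theorem exists_eq_val (hT : IsHenkin T) (v : hT.str.Val) : ∃ s, v = hT.val s := by
  choose s hs using fun σ n => hT.cls_surjective (v σ n)
  exact ⟨s, by funext σ n; exact (hs σ n).symm⟩

/-- The term model of a Henkin set. -/
def model (hT : IsHenkin T) : Model where
  toStr := hT.str
  sat_ax φ h v := by
    obtain ⟨s, rfl⟩ := hT.exists_eq_val v
    exact (hT.sat_val s φ).2 (hT.proves_subst h s)

end IsHenkin

/-- Completeness: what holds in all extensional models is derivable. -/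
theorem RCA0ω.of_sat {φ : Fm} (h : ∀ (M : Model) (v : M.Val), Str.Sat v φ) : RCA0ω φ := by
  by_contra hφ
  have hcon : Con [φ.neg] := fun h' => hφ (.by_contra h')
  obtain ⟨T, hT, hmem⟩ := hcon.exists_isHenkin
  have h1 := (hT.sat_val Sub.id φ).1 (h hT.model _)
  rw [Fm.subst_id] at h1
  exact hT.bot (hT.mp (hmem _ (by simp [Fm.neg])) h1)

/-! ## Abstraction -/

/-- The term `λ x. t` where `x` is the variable `n` of type `σ`; other variables are not renamed. -/
def Tm.abs (σ : FinTy) (n : ℕ) : {τ : FinTy} → Tm τ → Tm (σ ⇒ τ)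
  | _, .var τ m =>
    if h : σ = τ ∧ m = n then
      h.1 ▸ (.Sc σ (σ ⇒ σ) σ ⬝ .K σ (σ ⇒ σ) ⬝ .K σ σ)
    else .K τ σ ⬝ .var τ m
  | _, .app f x => .Sc _ _ _ ⬝ f.abs σ n ⬝ x.abs σ n
  | _, t => .K _ _ ⬝ t

/-- All variables of the term satisfy `S`. -/
def Tm.VarsIn (S : FinTy → ℕ → Prop) : {σ : FinTy} → Tm σ → Prop
  | _, .var σ n => S σ n
  | _, .app f x => f.VarsIn S ∧ x.VarsIn S
  | _, _ => True

theorem Tm.closed_iff {σ : FinTy} (t : Tm σ) : t.Closed ↔ t.VarsIn fun _ _ => False := by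
  induction t <;> simp_all [Tm.Closed, Tm.VarsIn]

theorem Tm.Closed.varsIn {σ : FinTy} {t : Tm σ} (h : t.Closed) (S : FinTy → ℕ → Prop) :
    t.VarsIn S := by
  induction t <;> simp_all [Tm.Closed, Tm.VarsIn]

theorem Tm.varsIn_abs (S : FinTy → ℕ → Prop) (σ : FinTy) (n : ℕ) {τ : FinTy} (t : Tm τ) :
    (t.abs σ n).VarsIn S ↔ t.VarsIn fun ρ m => S ρ m ∨ σ = ρ ∧ m = n := by
  induction t with
  | var τ m =>
    by_cases h : σ = τ ∧ m = n
    · obtain ⟨rfl, rfl⟩ := h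
      simp [Tm.abs, Tm.VarsIn]
    · simp [Tm.abs, Tm.VarsIn, h]
  | app f x hf hx => simp [Tm.abs, Tm.VarsIn, hf, hx]
  | _ => simp [Tm.abs, Tm.VarsIn]

/-! ## Models -/

namespace Str

instance {M : Str} {σ τ : FinTy} : CoeFun (M.C (σ ⇒ τ)) (fun _ => M.C σ → M.C τ) := ⟨M.app⟩

/-- An element of every type. -/
def point (M : Str) : (σ : FinTy) → M.C σ
  | .zero => M.zero
  | .arrow σ τ => M.K τ σ (M.point τ)

instance {M : Str} : Inhabited M.Val := ⟨fun σ _ => M.point σ⟩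

/-- Change the value of the variable `n` of type `σ` to `a`. -/
def Val.set {M : Str} {σ : FinTy} (v : M.Val) (n : ℕ) (a : M.C σ) : M.Val := fun τ m =>
  if h : σ = τ ∧ m = n then h.1 ▸ a else v τ m

section
variable {M : Str} {σ : FinTy} (v : M.Val) (n : ℕ) (a : M.C σ)

@[simp] theorem Val.set_self : v.set n a σ n = a := by simp [Val.set]

@[simp] theorem Val.set_of_ne_index {m : ℕ} (h : m ≠ n) (τ : FinTy) : v.set n a τ m = v τ m := by
  simp [Val.set, h]

@[simp] theorem Val.set_of_ne_type {τ : FinTy} (h : σ ≠ τ) (m : ℕ) : v.set n a τ m = v τ m := by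
  simp [Val.set, h]

end

end Str

namespace Model

open Str

variable {M : Model} {ρ σ τ : FinTy}

instance : Zero (M.C ty0) := ⟨M.zero⟩

/-- The successor function on the numbers of a model. -/
def suc (x : M.C ty0) : M.C ty0 := M.succ x

@[simp] theorem zero_eq : M.zero = 0 := rfl

@[simp] theorem succ_app (x : M.C ty0) : M.succ x = suc x := rfl

@[simp] theorem K_app (x : M.C σ) (y : M.C τ) : M.K σ τ x y = x := by
  -- The indices `0` and `1` are distinct because the two types may coincide.
  have := M.sat_ax _ (.K_eq σ τ (.var σ 0) (.var τ 1))
    (Val.set (Val.set default 0 x) 1 y)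
  simpa [sat_eqAt, eval] using this

@[simp] theorem Sc_app (x : M.C (ρ ⇒ σ ⇒ τ)) (y : M.C (ρ ⇒ σ)) (z : M.C ρ) :
    M.Sc ρ σ τ x y z = x z (y z) := by
  have := M.sat_ax _ (.Sc_eq ρ σ τ (.var _ 0) (.var _ 1) (.var _ 2))
    (Val.set (Val.set (Val.set default 0 x) 1 y) 2 z)
  simpa [sat_eqAt, eval] using this

@[simp] theorem rec0_zero (y : M.C ty0) (z : M.C (ty0 ⇒ ty0 ⇒ ty0)) : M.rec0 0 y z = y := by
  have := M.sat_ax _ (.rec0_zero (.var _ 1) (.var _ 2)) (Val.set (Val.set default 1 y) 2 z)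
  simpa [Sat, eval] using this

@[simp] theorem rec0_suc (x y : M.C ty0) (z : M.C (ty0 ⇒ ty0 ⇒ ty0)) :
    M.rec0 (suc x) y z = z (M.rec0 x y z) x := by
  have := M.sat_ax _ (.rec0_succ (.var _ 0) (.var _ 1) (.var _ 2))
    (Val.set (Val.set (Val.set default 0 x) 1 y) 2 z)
  simpa [Sat, eval] using this

@[simp] theorem suc_ne_zero (x : M.C ty0) : suc x ≠ 0 := by
  have := M.sat_ax _ .succ_ne_zero (Val.set default 0 x)
  simpa [Sat, eval, Fm.neg] using this

@[simp] theorem eval_abs (v : M.Val) (n : ℕ) (t : Tm τ) (a : M.C σ) :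
    eval v (t.abs σ n) a = eval (v.set n a) t := by
  induction t with
  | var τ m =>
    by_cases h : σ = τ ∧ m = n
    · obtain ⟨rfl, rfl⟩ := h
      simp [Tm.abs, eval]
    · simp [Tm.abs, h, eval, Val.set]
  | app f x hf hx => simp [Tm.abs, eval, hf, hx]
  | _ => simp [Tm.abs, eval]

theorem eval_congr (v v' : M.Val) (t : Tm τ) (h : t.VarsIn fun σ n => v σ n = v' σ n) :
    eval v t = eval v' t := by
  induction t with
  | var σ n => exact h
  | app f x hf hx => rw [eval, eval, hf h.1, hx h.2]
  | _ => rfl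

theorem eval_closed {t : Tm τ} (h : t.Closed) (v v' : M.Val) : eval v t = eval v' t :=
  eval_congr v v' t (h.varsIn _)

/-! ### Representable functions -/

/-- The function `F` is given by an element of the model. -/
def Rep (F : M.C σ → M.C τ) : Prop := ∃ f : M.C (σ ⇒ τ), ∀ x, f x = F x

theorem Rep.id : Rep fun x : M.C σ => x :=
  ⟨eval default ((Tm.var σ 0).abs σ 0), fun x => by simp [eval]⟩

theorem Rep.const (a : M.C τ) : Rep fun _ : M.C σ => a := ⟨M.K τ σ a, fun x => by simp⟩

theorem Rep.app {F : M.C ρ → M.C (σ ⇒ τ)} {G : M.C ρ → M.C σ} (hF : Rep F) (hG : Rep G) :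
    Rep fun x => F x (G x) := by
  obtain ⟨f, hf⟩ := hF
  obtain ⟨g, hg⟩ := hG
  exact ⟨M.Sc _ _ _ f g, fun x => by simp [hf, hg]⟩

theorem Rep.app_const (f : M.C (σ ⇒ τ)) {G : M.C ρ → M.C σ} (hG : Rep G) : Rep fun x => f (G x) :=
  (Rep.const f).app hG

theorem Rep.suc {F : M.C ρ → M.C ty0} (hF : Rep F) : Rep fun x => suc (F x) :=
  Rep.app_const M.succ hF

/-! ### Induction and choice -/

theorem induction_of_sat (φ : Fm) (hφ : φ.QuantifierFree) (v : M.Val)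
    (h0 : Sat (Val.cons (0 : M.C ty0) v) φ)
    (hs : ∀ a : M.C ty0, Sat (Val.cons a v) φ → Sat (Val.cons (Model.suc a) v) φ) (a : M.C ty0) :
    Sat (Val.cons a v) φ := by
  have := M.sat_ax _ (.qf_ind φ hφ) v
  simp only [Sat, sat_inst, sat_subst, Val.sub_cons, Val.cons_sub_shift, eval, Val.cons_zero,
    succ_app, zero_eq] at this
  exact this h0 hs a

/-- The numbers of a model carry induction only for quantifier-free formulas. A disjunction of two
equations between representable functions is the strongest form needed below. -/
theorem induction_or {F G F' G' : M.C ty0 → M.C ty0} (hF : Rep F) (hG : Rep G) (hF' : Rep F')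
    (hG' : Rep G') (h0 : F 0 = G 0 ∨ F' 0 = G' 0)
    (hs : ∀ a, (F a = G a ∨ F' a = G' a) →
      (F (Model.suc a) = G (Model.suc a) ∨ F' (Model.suc a) = G' (Model.suc a))) (a : M.C ty0) :
    F a = G a ∨ F' a = G' a := by
  obtain ⟨f, hf⟩ := hF
  obtain ⟨g, hg⟩ := hG
  obtain ⟨f', hf'⟩ := hF'
  obtain ⟨g', hg'⟩ := hG'
  let e (n : ℕ) : Tm ty0 := .var ty1 n ⬝ .var ty0 0
  have key (a : M.C ty0) : Sat (Val.cons a (Val.set (Val.set (Val.set (Val.set default 0 f) 1 g) 2 f')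
      3 g')) (e 0 ≐ e 1 ⋎ e 2 ≐ e 3) ↔ (F a = G a ∨ F' a = G' a) := by
    simp [e, Sat, eval, Fm.or, Fm.neg, Val.cons_of_ne, hf, hg, hf', hg', imp_iff_not_or]
  rw [← key]
  exact induction_of_sat _ (by simp [e, Fm.or, Fm.neg, Fm.QuantifierFree]) _ ((key 0).2 h0)
    (fun a h => (key _).2 (hs a ((key a).1 h))) a

theorem induction_eq {F G : M.C ty0 → M.C ty0} (hF : Rep F) (hG : Rep G) (h0 : F 0 = G 0)
    (hs : ∀ a, F a = G a → F (Model.suc a) = G (Model.suc a)) (a : M.C ty0) : F a = G a := by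
  have := induction_or hF hG hF hG (.inl h0) (fun a h => .inl (hs a (or_self_iff.1 h))) a
  exact or_self_iff.1 this

/-- The quantifier-free matrix is given as the zero set of `g`, so this one instance of the schema
suffices for all later choices. -/
theorem exists_choice (g : M.C (ty1 ⇒ ty0 ⇒ ty0)) (h : ∀ f, ∃ n, g f n = 0) :
    ∃ F : M.C ty2, ∀ f, g f (F f) = 0 := by
  have := M.sat_ax _ (.qf_ac (.var (ty1 ⇒ ty0 ⇒ ty0) 0 ⬝ .var ty1 0 ⬝ .var ty0 0 ≐ .zero) trivial)
    (Val.set default 0 g)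
  simpa [Sat, Fm.ex, Fm.neg, Fm.subst, Tm.subst, eval, Sub.cons_of_ne, Sub.shift,
    Val.cons_of_ne, h] using this

/-! ### Addition and order -/

-- The step function is the value of `dropSnd .succ`, so addition agrees definitionally with the
-- term `add`.
instance : Add (M.C ty0) :=
  ⟨fun x y => M.rec0 y x (M.Sc ty0 ty0 (ty0 ⇒ ty0) (M.K (ty0 ⇒ ty0 ⇒ ty0) ty0 (M.K ty0 ty0)) M.succ)⟩

@[simp] theorem eval_add (v : M.Val) (x y : Tm ty0) :
    eval v (HigherOrderRM.add x y) = eval v x + eval v y := rfl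

@[simp] theorem add_zero (x : M.C ty0) : x + 0 = x := rec0_zero _ _

@[simp] theorem add_suc (x y : M.C ty0) : x + suc y = suc (x + y) := by
  refine (rec0_suc _ _ _).trans ?_
  simp only [Sc_app, K_app]
  rfl

theorem Rep.add {F G : M.C ρ → M.C ty0} (hF : Rep F) (hG : Rep G) : Rep fun x => F x + G x := by
  have h (x : M.C ρ) : F x + G x = eval default (((HigherOrderRM.add (.var ty0 0)
      (.var ty0 1)).abs ty0 1).abs ty0 0) (F x) (G x) := by
    simp [eval]
  simp only [h]
  exact (Rep.app_const _ hF).app hG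

@[simp] theorem zero_add (x : M.C ty0) : 0 + x = x :=
  induction_eq ((Rep.const 0).add .id) .id (add_zero 0) (fun a h => by rw [add_suc, h]) x

@[simp] theorem suc_add (x y : M.C ty0) : suc x + y = suc (x + y) :=
  induction_eq ((Rep.const _).add .id) ((Rep.const x).add .id).suc (by simp)
    (fun a h => by rw [add_suc, add_suc, h]) y

theorem add_comm (x y : M.C ty0) : x + y = y + x :=
  induction_eq ((Rep.const x).add .id) (Rep.id.add (.const x)) (by simp)
    (fun a h => by rw [add_suc, suc_add, h]) y

theorem add_assoc (x y z : M.C ty0) : x + y + z = x + (y + z) :=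
  induction_eq ((Rep.const (x + y)).add .id) ((Rep.const x).add ((Rep.const y).add .id)) (by simp)
    (fun a h => by simp [h]) z

end Model

/-! ### Predecessor, truncated subtraction, case distinction and order -/

/-- The predecessor function. -/
def predT : Tm ty1 :=
  .abs ty0 0 (.rec0 ⬝ .var ty0 0 ⬝ .zero ⬝ .abs ty0 1 (.abs ty0 2 (.var ty0 2)))

/-- Truncated subtraction. -/
def subT : Tm (ty0 ⇒ ty0 ⇒ ty0) :=
  .abs ty0 0 (.abs ty0 1 (.rec0 ⬝ .var ty0 1 ⬝ .var ty0 0 ⬝ .abs ty0 2 (.abs ty0 3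
    (predT ⬝ .var ty0 2))))

theorem predT_closed : predT.Closed := by
  simp [predT, Tm.closed_iff, Tm.varsIn_abs, Tm.VarsIn]

theorem subT_closed : subT.Closed := by
  simp [subT, Tm.closed_iff, Tm.varsIn_abs, Tm.VarsIn, predT_closed.varsIn]

/-- The function that maps `a b c` to `b` if `a = 0` and to `c` otherwise. -/
def condT : Tm (ty0 ⇒ ty0 ⇒ ty0 ⇒ ty0) :=
  .abs ty0 0 (.abs ty0 1 (.abs ty0 2 (.rec0 ⬝ .var ty0 0 ⬝ .var ty0 1 ⬝
    .abs ty0 3 (.abs ty0 4 (.var ty0 2)))))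

theorem condT_closed : condT.Closed := by
  simp [condT, Tm.closed_iff, Tm.varsIn_abs, Tm.VarsIn]

namespace Model

open Str

variable {M : Model} {ρ : FinTy}

def pred (x : M.C ty0) : M.C ty0 := eval default predT x

@[simp] theorem eval_predT (v : M.Val) (x : M.C ty0) : eval v predT x = pred x := by
  rw [pred, eval_closed predT_closed v]

@[simp] theorem pred_zero : pred (0 : M.C ty0) = 0 := by simp [pred, predT, eval]

@[simp] theorem pred_suc (x : M.C ty0) : pred (suc x) = x := by simp [pred, predT, eval]

theorem Rep.pred {F : M.C ρ → M.C ty0} (hF : Rep F) : Rep fun x => pred (F x) :=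
  Rep.app_const (eval default predT) hF

theorem eq_zero_or_suc (x : M.C ty0) : x = 0 ∨ ∃ y, x = suc y := by
  -- The predecessor removes the existential quantifier, leaving a formula to which induction
  -- applies.
  have h : x = 0 ∨ x = Model.suc (Model.pred x) :=
    induction_or .id (.const 0) .id (Rep.pred .id).suc (by simp) (fun a _ => by right; simp) x
  exact h.imp_right fun h => ⟨_, h⟩

instance : _root_.Sub (M.C ty0) := ⟨fun x y => eval default subT x y⟩

@[simp] theorem eval_subT (v : M.Val) (x y : M.C ty0) : eval v subT x y = x - y := by
  rw [eval_closed subT_closed v]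
  rfl

@[simp] theorem sub_zero (x : M.C ty0) : x - 0 = x := by
  rw [← eval_subT default]
  simp [subT, eval]

@[simp] theorem sub_suc (x y : M.C ty0) : x - suc y = pred (x - y) := by
  rw [← eval_subT default, ← eval_subT default]
  simp only [subT, eval_abs, eval, Val.set_self, ne_eq, not_false_eq_true, Val.set_of_ne_index,
    zero_ne_one, rec0_suc, Nat.reduceEqDiff, eval_predT]
  -- The two recursions evaluate the same step term under assignments that differ at the counter;
  -- the step term is closed, so the assignment is immaterial.
  rw [eval_closed _ _ ((Val.set default 0 x).set 1 y)]
  simp [Tm.closed_iff, Tm.varsIn_abs, Tm.VarsIn, predT_closed.varsIn]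

theorem Rep.sub {F G : M.C ρ → M.C ty0} (hF : Rep F) (hG : Rep G) : Rep fun x => F x - G x :=
  (Rep.app_const (eval default subT) hF).app hG

@[simp] theorem zero_sub (x : M.C ty0) : 0 - x = 0 :=
  induction_eq ((Rep.const 0).sub .id) (.const 0) (by simp) (fun a h => by simp [h]) x

theorem suc_sub_suc (x y : M.C ty0) : suc x - suc y = x - y :=
  induction_eq ((Rep.const _).sub (Rep.suc .id)) ((Rep.const x).sub .id) (by simp)
    (fun a h => by rw [sub_suc, h, sub_suc]) y

@[simp] theorem add_sub_cancel (x y : M.C ty0) : x + y - x = y :=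
  induction_eq ((Rep.id.add (.const y)).sub .id) (.const y) (by simp)
    (fun a h => by rw [suc_add, suc_sub_suc, h]) x

theorem sub_add_self (x y : M.C ty0) : x - (x + y) = 0 :=
  induction_eq (Rep.id.sub (.add .id (.const y))) (.const 0) (by simp)
    (fun a h => by rw [suc_add, suc_sub_suc, h]) x

theorem add_eq_zero {x y : M.C ty0} : x + y = 0 ↔ x = 0 ∧ y = 0 := by
  rcases eq_zero_or_suc y with rfl | ⟨y, rfl⟩ <;> simp

/-- Totality of the order, with truncated subtraction supplying the witnesses so that the statement
is quantifier-free. -/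
theorem le_or_le (x y : M.C ty0) : x + (y - x) = y ∨ y + (x - y) = x := by
  refine induction_or ((Rep.const x).add (Rep.id.sub (.const x))) .id
    (Rep.id.add (.sub (.const x) .id)) (.const x) (by simp) (fun a h => ?_) y
  have key (c : M.C ty0) (hc : x + c = Model.suc a) :
      x + (Model.suc a - x) = Model.suc a := by
    rw [← hc, add_sub_cancel]
  rcases h with h | h
  · exact .inl (key (Model.suc (a - x)) (by rw [add_suc, h]))
  -- Either `a = x`, and the next number exceeds `x` by one, or `x` exceeds `a` by a successor and
  -- one unit moves across.
  · rcases eq_zero_or_suc (x - a) with h0 | ⟨w, h0⟩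
    · exact .inl (key (Model.suc 0) (by rw [h0, add_zero] at h; simp [h]))
    · right
      have : Model.suc a + w = x := by rw [← h, h0, add_suc, suc_add]
      rw [← this, add_sub_cancel]

noncomputable instance : LinearOrder (M.C ty0) where
  le x y := ∃ z, x + z = y
  le_refl x := ⟨0, add_zero x⟩
  le_trans := by
    rintro x _ _ ⟨a, rfl⟩ ⟨b, rfl⟩
    exact ⟨a + b, (add_assoc _ _ _).symm⟩
  le_antisymm := by
    rintro x y ⟨a, rfl⟩ ⟨b, h⟩
    rw [add_assoc] at h
    have h1 : a + b = 0 := by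
      rw [← add_sub_cancel x (a + b), h]
      simpa using add_sub_cancel x 0
    rw [(add_eq_zero.1 h1).1, add_zero]
  le_total x y := (le_or_le x y).imp (fun h => ⟨_, h⟩) (fun h => ⟨_, h⟩)
  toDecidableLE := Classical.decRel _

theorem le_iff {x y : M.C ty0} : x ≤ y ↔ ∃ z, x + z = y := Iff.rfl

theorem le_add_right (x y : M.C ty0) : x ≤ x + y := ⟨y, rfl⟩

theorem le_add_left (x y : M.C ty0) : x ≤ y + x := ⟨y, add_comm _ _⟩

theorem zero_le (x : M.C ty0) : 0 ≤ x := ⟨x, zero_add x⟩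

theorem sub_eq_zero {x y : M.C ty0} : x - y = 0 ↔ x ≤ y := by
  constructor
  · intro h
    rcases le_or_le x y with h1 | h1
    · exact ⟨_, h1⟩
    · rw [h, add_zero] at h1
      exact h1.ge
  · rintro ⟨z, rfl⟩
    exact sub_add_self x z

theorem lt_iff_suc_le {x y : M.C ty0} : x < y ↔ suc x ≤ y := by
  constructor
  · intro h
    obtain ⟨z, rfl⟩ := h.le
    rcases eq_zero_or_suc z with rfl | ⟨z, rfl⟩
    · simp at h
    · exact ⟨z, by simp⟩
  · rintro ⟨z, rfl⟩
    refine lt_of_le_not_ge ⟨suc z, by simp⟩ ?_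
    rintro ⟨w, h⟩
    have e : x + suc (z + w) = x := by rw [add_suc, ← suc_add, ← add_assoc, h]
    refine suc_ne_zero (z + w) ?_
    rw [← add_sub_cancel x (suc (z + w)), e]
    exact sub_eq_zero.2 le_rfl

theorem lt_suc_iff {x y : M.C ty0} : x < suc y ↔ x ≤ y := by
  rw [lt_iff_suc_le, ← sub_eq_zero, suc_sub_suc, sub_eq_zero]

theorem lt_suc_self (x : M.C ty0) : x < suc x := lt_suc_iff.2 le_rfl

theorem suc_sub_eq_zero {x y : M.C ty0} : suc x - y = 0 ↔ x < y := by
  rw [sub_eq_zero, lt_iff_suc_le]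

theorem lt_iff_exists {x y : M.C ty0} : x < y ↔ ∃ z, x + suc z = y := by
  simp [lt_iff_suc_le, le_iff]

@[simp] theorem sub_add_sub_eq_zero {x y : M.C ty0} : (x - y) + (y - x) = 0 ↔ x = y := by
  rw [add_eq_zero, sub_eq_zero, sub_eq_zero, le_antisymm_iff]

open Classical in
@[simp] theorem eval_condT (v : M.Val) (a b c : M.C ty0) :
    eval v condT a b c = if a = 0 then b else c := by
  rcases eq_zero_or_suc a with rfl | ⟨a, rfl⟩ <;> simp [condT, eval]

/-- Coded pairs. -/
def code (x y : M.C ty0) : M.C ty0 :=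
  eval (Val.set (Val.set default 0 x) 1 y) (HigherOrderRM.pair (.var ty0 0) (.var ty0 1))

@[simp] theorem eval_pair (v : M.Val) (x y : Tm ty0) :
    eval v (HigherOrderRM.pair x y) = code (eval v x) (eval v y) := by
  simp [code, HigherOrderRM.pair, HigherOrderRM.mul, HigherOrderRM.addFn, eval,
    HigherOrderRM.dropSnd]

/-- No theory of multiplication is needed: if `y` is a successor, the last step of the recursion for
the square already adds `x + y`. -/
theorem le_code (x y : M.C ty0) : y ≤ code x y := by
  have h : code x y = M.rec0 (x + y) 0 (M.Sc ty0 ty0 (ty0 ⇒ ty0)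
      (M.K (ty0 ⇒ ty0 ⇒ ty0) ty0 (M.K ty0 ty0))
      (eval (Val.set default 0 (x + y)) (addFn (.var ty0 0)))) + x := by
    simp [code, HigherOrderRM.pair, HigherOrderRM.mul, HigherOrderRM.addFn, eval,
      HigherOrderRM.dropSnd]
  rw [h]
  refine le_trans ?_ (le_add_right _ _)
  rcases eq_zero_or_suc y with rfl | ⟨k, rfl⟩
  · exact zero_le _
  · rw [add_suc, rec0_suc]
    have h' (a b : M.C ty0) : eval (Val.set default 0 a) (addFn (.var ty0 0)) b = b + a := by
      simp only [addFn, eval, Sc_app, K_app, Val.set_self]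
      rfl
    simp only [Sc_app, K_app, h']
    refine le_trans ?_ (le_add_left _ _)
    rw [← add_suc]
    exact le_add_left _ _

end Model

/-! ## The principles in a model -/

namespace Model

open Str

variable {M : Model} {τ : FinTy}

/-- `f` is a zero-finding functional. -/
def IsMu (μ : M.C ty2) : Prop := ∀ f : M.C ty1, (∃ n, f n = 0) → f (μ f) = 0

/-- `c` is a stable colouring of the pairs with two colours. -/
def IsStable (c : M.C ty1) : Prop :=
  (∀ x y, x < y → c (code x y) = 0 ∨ c (code x y) = suc 0) ∧
    ∀ x, ∃ i m, ∀ y, x < y → m < y → c (code x y) = i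

/-- `H` is infinite homogeneous for `c`. -/
def IsInfHom (c H : M.C ty1) : Prop :=
  (∀ n, H n = 0 ∨ H n = suc 0) ∧ (∀ k, ∃ x, k < x ∧ H x = suc 0) ∧
    ∃ i, ∀ x y, H x = suc 0 → H y = suc 0 → x < y → c (code x y) = i

def IsUsrt (Ψ : M.C ty11) : Prop := ∀ c : M.C ty1, IsStable c → IsInfHom c (Ψ c)

def Searches (Ψ Θ : M.C ty11) : Prop :=
  ∀ c : M.C ty1, IsStable c → ∀ k, k < Θ c k ∧ Ψ c (Θ c k) = suc 0

@[simp] theorem sat_and (v : M.Val) (φ ψ : Fm) : Sat v (φ ⋏ ψ) ↔ Sat v φ ∧ Sat v ψ := by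
  simp [Fm.and, Fm.neg, Sat]

@[simp] theorem sat_or (v : M.Val) (φ ψ : Fm) : Sat v (φ ⋎ ψ) ↔ Sat v φ ∨ Sat v ψ := by
  simp [Fm.or, Fm.neg, Sat, imp_iff_not_or]

@[simp] theorem sat_iff (v : M.Val) (φ ψ : Fm) : Sat v (φ.iff ψ) ↔
    (Sat v φ ↔ Sat v ψ) := by
  simp [Fm.iff, Sat, iff_def]

@[simp] theorem sat_ex (v : M.Val) (σ : FinTy) (φ : Fm) :
    Sat v (.ex σ φ) ↔ ∃ a : M.C σ, Sat (Val.cons a v) φ := by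
  simp [Fm.ex, Fm.neg, Sat]

@[simp] theorem sat_lt (v : M.Val) (x y : Tm ty0) : Sat v (lt x y) ↔ eval v x < eval v y := by
  simp [lt, Sat, eval, lt_iff_exists]

@[simp] theorem eval_one (v : M.Val) : eval v one = suc 0 := rfl

theorem sat_isStable (v : M.Val) : Sat v (twoColouring ⋏ stable) ↔ IsStable (v ty1 0) := by
  simp [twoColouring, stable, Sat, eval, IsStable, Val.cons_of_ne]

theorem sat_infiniteHomogeneous (v : M.Val) :
    Sat v infiniteHomogeneous ↔ IsInfHom (v ty1 1) (v ty1 0) := by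
  simp [infiniteHomogeneous, Sat, eval, IsInfHom, Val.cons_of_ne]

theorem sat_usrt (v : M.Val) (t : Tm ty11) : Sat v (usrt t) ↔ IsUsrt (eval v t) := by
  simp only [usrt, sat_inst, usrtBody, Sat, sat_isStable, sat_infiniteHomogeneous, eval]
  simp [IsUsrt, Val.cons_of_ne]

theorem sat_mu (v : M.Val) (t : Tm ty2) : Sat v (mu t) ↔ IsMu (eval v t) := by
  simp only [mu, sat_inst, muBody, Sat, sat_ex, eval]
  simp [IsMu, Val.cons_of_ne]

theorem sat_searches (v : M.Val) : Sat v searches ↔ Searches (v ty11 1) (v ty11 0) := by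
  simp only [searches, Sat, sat_isStable]
  simp [Sat, eval, Searches, Val.cons_of_ne]

/-- The value of a closed term. -/
def den (M : Model) (t : Tm τ) : M.C τ := eval default t

theorem eval_eq_den {t : Tm τ} (h : t.Closed) (v : M.Val) : eval v t = M.den t :=
  eval_closed h v _

end Model

/-! ## The closed terms -/

section
variable (S : FinTy → ℕ → Prop) (x y : Tm ty0)

@[simp] theorem varsIn_one : one.VarsIn S := by simp [one, Tm.VarsIn]

@[simp] theorem varsIn_add : (add x y).VarsIn S ↔ x.VarsIn S ∧ y.VarsIn S := by
  simp [add, dropSnd, Tm.VarsIn, and_comm]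

@[simp] theorem varsIn_pair : (pair x y).VarsIn S ↔ x.VarsIn S ∧ y.VarsIn S := by
  simp +contextual [pair, mul, addFn, dropSnd, Tm.VarsIn, and_comm]

end

/-- One step of a bounded search for a zero of `f`: keep the candidate `r` if it is a zero. -/
def searchStepT : Tm (ty1 ⇒ ty0 ⇒ ty0 ⇒ ty0) :=
  .abs ty1 0 <| .abs ty0 0 <| .abs ty0 1 <|
    condT ⬝ (.var ty1 0 ⬝ .var ty0 0) ⬝ .var ty0 0 ⬝ (.succ ⬝ .var ty0 1)

theorem searchStepT_closed : searchStepT.Closed := by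
  simp [searchStepT, Tm.closed_iff, Tm.varsIn_abs, Tm.VarsIn, condT_closed.varsIn]

-- Keeps a closed subterm folded, so that the value of each later term can be computed from the
-- values of its parts.
@[simp] theorem Model.eval_searchStepT {M : Model} (v : M.Val) :
    Str.eval v searchStepT = M.den searchStepT :=
  Model.eval_eq_den searchStepT_closed v

/-- A number that is a zero of `f` if there is a zero of `f` up to `k`. -/
def searchT : Tm (ty1 ⇒ ty0 ⇒ ty0) :=
  .abs ty1 0 <| .abs ty0 0 <|
    .rec0 ⬝ .var ty0 0 ⬝ .zero ⬝ (searchStepT ⬝ .var ty1 0)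

theorem searchT_closed : searchT.Closed := by
  simp [searchT, Tm.closed_iff, Tm.varsIn_abs, Tm.VarsIn, searchStepT_closed.varsIn]

@[simp] theorem Model.eval_searchT {M : Model} (v : M.Val) :
    Str.eval v searchT = M.den searchT :=
  Model.eval_eq_den searchT_closed v

/-- The function that is `0` where `f` is not. -/
def negT : Tm (ty1 ⇒ ty0 ⇒ ty0) :=
  .abs ty1 0 <| .abs ty0 0 <|
    condT ⬝ (.var ty1 0 ⬝ .var ty0 0) ⬝ one ⬝ .zero

theorem negT_closed : negT.Closed := by
  simp [negT, Tm.closed_iff, Tm.varsIn_abs, Tm.VarsIn, condT_closed.varsIn]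

@[simp] theorem Model.eval_negT {M : Model} (v : M.Val) :
    Str.eval v negT = M.den negT :=
  Model.eval_eq_den negT_closed v

/-- The colouring that gives the pair with code `p` the colour `1` if and only if `f` has a
zero up to `p`. -/
def colouringT : Tm (ty1 ⇒ ty0 ⇒ ty0) :=
  .abs ty1 0 <| .abs ty0 0 <|
    condT ⬝ (.var ty1 0 ⬝ (searchT ⬝ .var ty1 0 ⬝ .var ty0 0)) ⬝ one ⬝ .zero

theorem colouringT_closed : colouringT.Closed := by
  simp [colouringT, Tm.closed_iff, Tm.varsIn_abs, Tm.VarsIn, condT_closed.varsIn,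
    searchT_closed.varsIn]

@[simp] theorem Model.eval_colouringT {M : Model} (v : M.Val) :
    Str.eval v colouringT = M.den colouringT :=
  Model.eval_eq_den colouringT_closed v

/-- The zero-finding functional given by a functional `Θ` that searches homogeneous sets. -/
def muOfSearchT : Tm (ty11 ⇒ ty11 ⇒ ty1 ⇒ ty0) :=
  .abs ty11 0 <| .abs ty11 1 <| .abs ty1 0 <|
    searchT ⬝ .var ty1 0 ⬝ pair (.var ty11 1 ⬝ (colouringT ⬝ .var ty1 0) ⬝ .zero)
      (.var ty11 1 ⬝ (colouringT ⬝ .var ty1 0) ⬝ (.var ty11 1 ⬝ (colouringT ⬝ .var ty1 0) ⬝ .zero))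

theorem muOfSearchT_closed : muOfSearchT.Closed := by
  simp [muOfSearchT, Tm.closed_iff, Tm.varsIn_abs, Tm.VarsIn, searchT_closed.varsIn,
    colouringT_closed.varsIn]

@[simp] theorem Model.eval_muOfSearchT {M : Model} (v : M.Val) :
    Str.eval v muOfSearchT = M.den muOfSearchT :=
  Model.eval_eq_den muOfSearchT_closed v

/-- A function that is `0` if and only if its arguments are equal. -/
def eqT : Tm (ty0 ⇒ ty0 ⇒ ty0) :=
  .abs ty0 0 <| .abs ty0 1 <|
    add (subT ⬝ .var ty0 0 ⬝ .var ty0 1) (subT ⬝ .var ty0 1 ⬝ .var ty0 0)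

theorem eqT_closed : eqT.Closed := by
  simp [eqT, Tm.closed_iff, Tm.varsIn_abs, Tm.VarsIn, subT_closed.varsIn]

@[simp] theorem Model.eval_eqT {M : Model} (v : M.Val) :
    Str.eval v eqT = M.den eqT :=
  Model.eval_eq_den eqT_closed v

/-- A functional that is `0` if and only if `f` is constantly `0`. -/
def forallT : Tm (ty2 ⇒ ty1 ⇒ ty0) :=
  .abs ty2 0 <| .abs ty1 0 <|
    condT ⬝ (negT ⬝ .var ty1 0 ⬝ (.var ty2 0 ⬝ (negT ⬝ .var ty1 0))) ⬝ one ⬝ .zero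

theorem forallT_closed : forallT.Closed := by
  simp [forallT, Tm.closed_iff, Tm.varsIn_abs, Tm.VarsIn, condT_closed.varsIn, negT_closed.varsIn]

@[simp] theorem Model.eval_forallT {M : Model} (v : M.Val) :
    Str.eval v forallT = M.den forallT :=
  Model.eval_eq_den forallT_closed v

/-- `0` if and only if `y > m` implies `c(x, y) = i`. -/
def tailAtT : Tm (ty1 ⇒ ty0 ⇒ ty0 ⇒ ty0 ⇒ ty0 ⇒ ty0) :=
  .abs ty1 0 <| .abs ty0 0 <| .abs ty0 1 <| .abs ty0 2 <| .abs ty0 3 <|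
    condT ⬝ (subT ⬝ (.succ ⬝ .var ty0 2) ⬝ .var ty0 3) ⬝ (eqT ⬝ (.var ty1 0 ⬝
      pair (.var ty0 1) (.var ty0 3)) ⬝ .var ty0 0) ⬝ .zero

theorem tailAtT_closed : tailAtT.Closed := by
  simp [tailAtT, Tm.closed_iff, Tm.varsIn_abs, Tm.VarsIn, condT_closed.varsIn, subT_closed.varsIn,
    eqT_closed.varsIn]

@[simp] theorem Model.eval_tailAtT {M : Model} (v : M.Val) :
    Str.eval v tailAtT = M.den tailAtT :=
  Model.eval_eq_den tailAtT_closed v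

/-- `0` if and only if `c(x, y) = i` for all `y > n`. -/
def tailT : Tm (ty2 ⇒ ty1 ⇒ ty0 ⇒ ty0 ⇒ ty0 ⇒ ty0) :=
  .abs ty2 0 <| .abs ty1 0 <| .abs ty0 0 <| .abs ty0 1 <| .abs ty0 2 <|
    forallT ⬝ .var ty2 0 ⬝ (tailAtT ⬝ .var ty1 0 ⬝ .var ty0 0 ⬝ .var ty0 1 ⬝ .var ty0 2)

theorem tailT_closed : tailT.Closed := by
  simp [tailT, Tm.closed_iff, Tm.varsIn_abs, Tm.VarsIn, forallT_closed.varsIn,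
    tailAtT_closed.varsIn]

@[simp] theorem Model.eval_tailT {M : Model} (v : M.Val) :
    Str.eval v tailT = M.den tailT :=
  Model.eval_eq_den tailT_closed v

/-- A number after which `c(x, y) = i`, if there is one. -/
def modulusT : Tm (ty2 ⇒ ty1 ⇒ ty0 ⇒ ty0 ⇒ ty0) :=
  .abs ty2 0 <| .abs ty1 0 <| .abs ty0 0 <| .abs ty0 1 <|
    .var ty2 0 ⬝ (tailT ⬝ .var ty2 0 ⬝ .var ty1 0 ⬝ .var ty0 0 ⬝ .var ty0 1)

theorem modulusT_closed : modulusT.Closed := by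
  simp [modulusT, Tm.closed_iff, Tm.varsIn_abs, Tm.VarsIn, tailT_closed.varsIn]

@[simp] theorem Model.eval_modulusT {M : Model} (v : M.Val) :
    Str.eval v modulusT = M.den modulusT :=
  Model.eval_eq_den modulusT_closed v

/-- `0` if and only if `c(x, y) = i` for almost all `y`. -/
def limitT : Tm (ty2 ⇒ ty1 ⇒ ty0 ⇒ ty0 ⇒ ty0) :=
  .abs ty2 0 <| .abs ty1 0 <| .abs ty0 0 <| .abs ty0 1 <|
    tailT ⬝ .var ty2 0 ⬝ .var ty1 0 ⬝ .var ty0 0 ⬝ .var ty0 1 ⬝ (modulusT ⬝ .var ty2 0 ⬝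
      .var ty1 0 ⬝ .var ty0 0 ⬝ .var ty0 1)

theorem limitT_closed : limitT.Closed := by
  simp [limitT, Tm.closed_iff, Tm.varsIn_abs, Tm.VarsIn, tailT_closed.varsIn,
    modulusT_closed.varsIn]

@[simp] theorem Model.eval_limitT {M : Model} (v : M.Val) :
    Str.eval v limitT = M.den limitT :=
  Model.eval_eq_den limitT_closed v

/-- `0` if and only if `x > k` and `x` has limit colour `i`. -/
def candidateT : Tm (ty2 ⇒ ty1 ⇒ ty0 ⇒ ty0 ⇒ ty0 ⇒ ty0) :=
  .abs ty2 0 <| .abs ty1 0 <| .abs ty0 0 <| .abs ty0 1 <| .abs ty0 2 <|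
    add (subT ⬝ (.succ ⬝ .var ty0 1) ⬝ .var ty0 2) (limitT ⬝ .var ty2 0 ⬝ .var ty1 0 ⬝ .var ty0 0 ⬝
      .var ty0 2)

theorem candidateT_closed : candidateT.Closed := by
  simp [candidateT, Tm.closed_iff, Tm.varsIn_abs, Tm.VarsIn, subT_closed.varsIn,
    limitT_closed.varsIn]

@[simp] theorem Model.eval_candidateT {M : Model} (v : M.Val) :
    Str.eval v candidateT = M.den candidateT :=
  Model.eval_eq_den candidateT_closed v

/-- A number above `k` with limit colour `i`, if there is one. -/
def nextT : Tm (ty2 ⇒ ty1 ⇒ ty0 ⇒ ty0 ⇒ ty0) :=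
  .abs ty2 0 <| .abs ty1 0 <| .abs ty0 0 <| .abs ty0 1 <|
    .var ty2 0 ⬝ (candidateT ⬝ .var ty2 0 ⬝ .var ty1 0 ⬝ .var ty0 0 ⬝ .var ty0 1)

theorem nextT_closed : nextT.Closed := by
  simp [nextT, Tm.closed_iff, Tm.varsIn_abs, Tm.VarsIn, candidateT_closed.varsIn]

@[simp] theorem Model.eval_nextT {M : Model} (v : M.Val) :
    Str.eval v nextT = M.den nextT :=
  Model.eval_eq_den nextT_closed v

/-- `0` if and only if there is a number above `k` with limit colour `i`. -/
def hasNextT : Tm (ty2 ⇒ ty1 ⇒ ty0 ⇒ ty0 ⇒ ty0) :=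
  .abs ty2 0 <| .abs ty1 0 <| .abs ty0 0 <| .abs ty0 1 <|
    candidateT ⬝ .var ty2 0 ⬝ .var ty1 0 ⬝ .var ty0 0 ⬝ .var ty0 1 ⬝ (nextT ⬝ .var ty2 0 ⬝
      .var ty1 0 ⬝ .var ty0 0 ⬝ .var ty0 1)

theorem hasNextT_closed : hasNextT.Closed := by
  simp [hasNextT, Tm.closed_iff, Tm.varsIn_abs, Tm.VarsIn, candidateT_closed.varsIn,
    nextT_closed.varsIn]

@[simp] theorem Model.eval_hasNextT {M : Model} (v : M.Val) :
    Str.eval v hasNextT = M.den hasNextT :=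
  Model.eval_eq_den hasNextT_closed v

/-- A limit colour of unboundedly many numbers. -/
def colourT : Tm (ty2 ⇒ ty1 ⇒ ty0) :=
  .abs ty2 0 <| .abs ty1 0 <|
    condT ⬝ (forallT ⬝ .var ty2 0 ⬝ (hasNextT ⬝ .var ty2 0 ⬝ .var ty1 0 ⬝ one)) ⬝ one ⬝ .zero

theorem colourT_closed : colourT.Closed := by
  simp [colourT, Tm.closed_iff, Tm.varsIn_abs, Tm.VarsIn, condT_closed.varsIn,
    forallT_closed.varsIn, hasNextT_closed.varsIn]

@[simp] theorem Model.eval_colourT {M : Model} (v : M.Val) :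
    Str.eval v colourT = M.den colourT :=
  Model.eval_eq_den colourT_closed v

/-- The element after `r` in the enumeration of a homogeneous set. -/
def enumStepT : Tm (ty2 ⇒ ty1 ⇒ ty0 ⇒ ty0 ⇒ ty0) :=
  .abs ty2 0 <| .abs ty1 0 <| .abs ty0 0 <| .abs ty0 1 <|
    nextT ⬝ .var ty2 0 ⬝ .var ty1 0 ⬝ (colourT ⬝ .var ty2 0 ⬝ .var ty1 0) ⬝
      add (.var ty0 0) (modulusT ⬝ .var ty2 0 ⬝ .var ty1 0 ⬝ (colourT ⬝ .var ty2 0 ⬝ .var ty1 0) ⬝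
      .var ty0 0)

theorem enumStepT_closed : enumStepT.Closed := by
  simp [enumStepT, Tm.closed_iff, Tm.varsIn_abs, Tm.VarsIn, nextT_closed.varsIn,
    colourT_closed.varsIn, modulusT_closed.varsIn]

@[simp] theorem Model.eval_enumStepT {M : Model} (v : M.Val) :
    Str.eval v enumStepT = M.den enumStepT :=
  Model.eval_eq_den enumStepT_closed v

/-- The increasing enumeration of a homogeneous set. -/
def enumT : Tm (ty2 ⇒ ty1 ⇒ ty0 ⇒ ty0) :=
  .abs ty2 0 <| .abs ty1 0 <| .abs ty0 0 <|
    .rec0 ⬝ .var ty0 0 ⬝ (nextT ⬝ .var ty2 0 ⬝ .var ty1 0 ⬝ (colourT ⬝ .var ty2 0 ⬝ .var ty1 0) ⬝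
      .zero) ⬝ (enumStepT ⬝ .var ty2 0 ⬝ .var ty1 0)

theorem enumT_closed : enumT.Closed := by
  simp [enumT, Tm.closed_iff, Tm.varsIn_abs, Tm.VarsIn, nextT_closed.varsIn, colourT_closed.varsIn,
    enumStepT_closed.varsIn]

@[simp] theorem Model.eval_enumT {M : Model} (v : M.Val) :
    Str.eval v enumT = M.den enumT :=
  Model.eval_eq_den enumT_closed v

/-- `0` if and only if `x` is the value of the enumeration at `n`. -/
def isValueT : Tm (ty2 ⇒ ty1 ⇒ ty0 ⇒ ty0 ⇒ ty0) :=
  .abs ty2 0 <| .abs ty1 0 <| .abs ty0 0 <| .abs ty0 1 <|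
    eqT ⬝ (enumT ⬝ .var ty2 0 ⬝ .var ty1 0 ⬝ .var ty0 1) ⬝ .var ty0 0

theorem isValueT_closed : isValueT.Closed := by
  simp [isValueT, Tm.closed_iff, Tm.varsIn_abs, Tm.VarsIn, eqT_closed.varsIn, enumT_closed.varsIn]

@[simp] theorem Model.eval_isValueT {M : Model} (v : M.Val) :
    Str.eval v isValueT = M.den isValueT :=
  Model.eval_eq_den isValueT_closed v

/-- The range of the enumeration. -/
def homogeneousT : Tm (ty2 ⇒ ty1 ⇒ ty0 ⇒ ty0) :=
  .abs ty2 0 <| .abs ty1 0 <| .abs ty0 0 <|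
    condT ⬝ (isValueT ⬝ .var ty2 0 ⬝ .var ty1 0 ⬝ .var ty0 0 ⬝ (.var ty2 0 ⬝ (isValueT ⬝
      .var ty2 0 ⬝ .var ty1 0 ⬝ .var ty0 0))) ⬝ one ⬝ .zero

theorem homogeneousT_closed : homogeneousT.Closed := by
  simp [homogeneousT, Tm.closed_iff, Tm.varsIn_abs, Tm.VarsIn, condT_closed.varsIn,
    isValueT_closed.varsIn]

@[simp] theorem Model.eval_homogeneousT {M : Model} (v : M.Val) :
    Str.eval v homogeneousT = M.den homogeneousT :=
  Model.eval_eq_den homogeneousT_closed v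

namespace Model

open Str
open scoped Classical

variable {M : Model}

/-! ## From homogeneous sets to zero-finding functionals -/

theorem den_searchStepT (f : M.C ty1) (r i : M.C ty0) :
    M.den searchStepT f r i = if f r = 0 then r else suc i := by
  rw [den, searchStepT]
  simp [eval]

theorem den_searchT_suc (f : M.C ty1) (k : M.C ty0) :
    M.den searchT f (suc k) =
      if f (M.den searchT f k) = 0 then M.den searchT f k else suc k := by
  have h (k : M.C ty0) : M.den searchT f k = M.rec0 k 0 (M.den searchStepT f) := by
    rw [den, searchT]
    simp [eval]
  simp only [h, rec0_suc, den_searchStepT]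

theorem den_searchT_zero (f : M.C ty1) : M.den searchT f 0 = 0 := by
  rw [den, searchT]
  simp [eval]

theorem den_searchT {f : M.C ty1} {j k : M.C ty0} (hj : f j = 0) (hk : j ≤ k) :
    f (M.den searchT f k) = 0 := by
  obtain ⟨d, rfl⟩ := hk
  refine induction_eq (F := fun d => f (M.den searchT f (j + d))) (G := fun _ => 0)
    (Rep.app_const _ (Rep.app_const _ ((Rep.const j).add .id))) (Rep.const 0) ?_ (fun d h => ?_) d
  -- The induction starts at `j`: there the candidate is either an earlier zero or `j` itself. From
  -- then on a zero, once found, is kept.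
  · rcases eq_zero_or_suc j with rfl | ⟨i, rfl⟩
    · simpa [den_searchT_zero] using hj
    · simp only [add_zero, den_searchT_suc]
      split_ifs with h
      · exact h
      · exact hj
  · simp only [add_suc, den_searchT_suc, h, if_true]

theorem den_colouringT (f : M.C ty1) (p : M.C ty0) :
    M.den colouringT f p = if f (M.den searchT f p) = 0 then suc 0 else 0 := by
  rw [den, colouringT]
  simp [eval]

theorem den_colouringT_eq_one {f : M.C ty1} {j p : M.C ty0} (hj : f j = 0) (hp : j ≤ p) :
    M.den colouringT f p = suc 0 := by
  rw [den_colouringT, if_pos (den_searchT hj hp)]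

/-- Stability needs no knowledge of whether `f` has a zero; a classical case distinction supplies
the limit colour. -/
theorem isStable_colouringT (f : M.C ty1) : IsStable (M.den colouringT f) := by
  refine ⟨fun x y _ => ?_, fun x => ?_⟩
  · rw [den_colouringT]
    split_ifs <;> simp
  · by_cases h : ∃ j, f j = 0
    · obtain ⟨j, hj⟩ := h
      exact ⟨suc 0, j, fun y _ hy => den_colouringT_eq_one hj (hy.le.trans (le_code x y))⟩
    · exact ⟨0, 0, fun y _ _ => by rw [den_colouringT, if_neg fun h' => h ⟨_, h'⟩]⟩

theorem IsUsrt.apply_searchT {Ψ : M.C ty11} (hΨ : IsUsrt Ψ) {f : M.C ty1} (hf : ∃ n, f n = 0)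
    {x y : M.C ty0} (hx : Ψ (M.den colouringT f) x = suc 0)
    (hy : Ψ (M.den colouringT f) y = suc 0) (hxy : x < y) :
    f (M.den searchT f (code x y)) = 0 := by
  obtain ⟨n, hn⟩ := hf
  obtain ⟨-, hinf, i, hi⟩ := hΨ _ (isStable_colouringT f)
  -- An element of the homogeneous set beyond both `x` and the zero forces the common colour to be
  -- `1`; then the pair `(x, y)` has colour `1` too.
  obtain ⟨z, hz, hzH⟩ := hinf (max x n)
  have h1 := hi x z hx hzH ((le_max_left _ _).trans_lt hz)
  have hle : n ≤ code x z := ((le_max_right _ _).trans hz.le).trans (le_code x z)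
  rw [den_colouringT_eq_one hn hle] at h1
  have h2 := hi x y hx hy hxy
  rw [← h1, den_colouringT] at h2
  by_contra h
  rw [if_neg h] at h2
  exact suc_ne_zero _ h2.symm

theorem IsUsrt.isMu_muOfSearchT {Ψ Θ : M.C ty11} (hΨ : IsUsrt Ψ) (hΘ : Searches Ψ Θ) :
    IsMu (M.den muOfSearchT Ψ Θ) := by
  intro f hf
  have h : M.den muOfSearchT Ψ Θ f = M.den searchT f (code (Θ (M.den colouringT f) 0)
      (Θ (M.den colouringT f) (Θ (M.den colouringT f) 0))) := by
    rw [den, muOfSearchT]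
    simp [eval]
  have hs := hΘ _ (isStable_colouringT f)
  rw [h]
  exact hΨ.apply_searchT hf (hs _).2 (hs _).2 (hs _).1

theorem den_eqT {x y : M.C ty0} : M.den eqT x y = 0 ↔ x = y := by
  rw [den, eqT]
  simp [eval]

/-- Choice applies because the colouring attached to `f` is stable for every `f`, so the existence
of elements of its homogeneous set holds without a premise. -/
theorem IsUsrt.exists_isMu {Ψ : M.C ty11} (hΨ : IsUsrt Ψ) : ∃ μ : M.C ty2, IsMu μ := by
  have hinf (f : M.C ty1) := (hΨ _ (isStable_colouringT f)).2.1
  let Ψ' : Tm ty0 := .var ty11 0 ⬝ (colouringT ⬝ .var ty1 0) ⬝ .var ty0 0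
  let v : M.Val := Val.set default 0 Ψ
  obtain ⟨F, hF⟩ := exists_choice
    (eval v (((eqT ⬝ Ψ' ⬝ one).abs ty0 0).abs ty1 0)) (fun f => by
      obtain ⟨x, -, hx⟩ := hinf f 0
      exact ⟨x, by simpa [v, Ψ', eval, den_eqT] using hx⟩)
  let w : M.Val := Val.set v 0 F
  -- The first choice functional is a parameter of the second, which picks a larger element of the
  -- same set.
  obtain ⟨G, hG⟩ := exists_choice
    (eval w (((add (eqT ⬝ Ψ' ⬝ one) (subT ⬝ (.succ ⬝ (.var ty2 0 ⬝ .var ty1 0)) ⬝ .var ty0 0)).abs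
      ty0 0).abs ty1 0)) (fun f => by
      obtain ⟨x, hx, hxH⟩ := hinf f (F f)
      exact ⟨x, by simpa [v, w, Ψ', eval, den_eqT, add_eq_zero, suc_sub_eq_zero] using ⟨hxH, hx⟩⟩)
  simp only [v, w, Ψ', eval_abs, eval, eval_add, add_eq_zero, eval_eqT, den_eqT] at hF hG
  simp [suc_sub_eq_zero] at hF hG
  refine ⟨eval (Val.set w 1 G) ((searchT ⬝ .var ty1 0 ⬝ pair (.var ty2 0 ⬝ .var ty1 0)
    (.var ty2 1 ⬝ .var ty1 0)).abs ty1 0), fun f hf => ?_⟩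
  simp [eval, w]
  exact hΨ.apply_searchT hf (hF f) (hG f).1 (hG f).2

/-- Direct choice is hampered by the premise that `c` is stable, which is not quantifier-free.
Applying `μ` to the membership test needs no such premise: the value is constrained only when an
element exists. -/
theorem IsMu.exists_searches {μ : M.C ty2} (hμ : IsMu μ) {Ψ : M.C ty11} (hΨ : IsUsrt Ψ) :
    ∃ Θ : M.C ty11, Searches Ψ Θ := by
  let t : Tm ty11 := .abs ty1 0 <| .abs ty0 0 <| .var ty2 0 ⬝ .abs ty0 1
    (add (subT ⬝ (.succ ⬝ .var ty0 0) ⬝ .var ty0 1)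
      (eqT ⬝ (.var ty11 0 ⬝ .var ty1 0 ⬝ .var ty0 1) ⬝ one))
  refine ⟨eval (Val.set (Val.set default 0 μ) 0 Ψ) t, fun c hc k => ?_⟩
  obtain ⟨x, hx⟩ := (hΨ c hc).2.1 k
  let g : M.C ty1 := eval (Val.set (Val.set (Val.set (Val.set default 0 μ) 0 Ψ) 0 c) 0 k)
    (.abs ty0 1 (add (subT ⬝ (.succ ⬝ .var ty0 0) ⬝ .var ty0 1)
      (eqT ⬝ (.var ty11 0 ⬝ .var ty1 0 ⬝ .var ty0 1) ⬝ one)))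
  have hg (n : M.C ty0) : g n = 0 ↔ k < n ∧ Ψ c n = suc 0 := by
    simp [g, eval, add_eq_zero, den_eqT, suc_sub_eq_zero]
  have := hμ g ⟨x, (hg x).2 hx⟩
  rw [hg] at this
  simpa [t, eval] using this

/-! ## From zero-finding functionals to homogeneous sets -/

theorem den_negT (f : M.C ty1) (x : M.C ty0) : M.den negT f x = 0 ↔ f x ≠ 0 := by
  rw [den, negT]
  simp [eval]

variable {μ : M.C ty2}

/-- Applied to the negation of `f`, the functional `μ` proposes a counterexample; testing that
single number settles the universal statement. -/
theorem IsMu.den_forallT (hμ : IsMu μ) (f : M.C ty1) :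
    M.den forallT μ f = 0 ↔ ∀ x, f x = 0 := by
  have h : M.den forallT μ f = 0 ↔ M.den negT f (μ (M.den negT f)) ≠ 0 := by
    rw [den, forallT]
    simp [eval]
  rw [h]
  constructor
  · intro h1 x
    by_contra hx
    exact h1 (hμ _ ⟨x, (den_negT f x).2 hx⟩)
  · intro h1 h2
    exact (den_negT _ _).1 h2 (h1 _)

theorem IsMu.den_tailT (hμ : IsMu μ) (c : M.C ty1) (i x m : M.C ty0) :
    M.den tailT μ c i x m = 0 ↔ ∀ y, m < y → c (code x y) = i := by
  have h : M.den tailT μ c i x m = M.den forallT μ (M.den tailAtT c i x m) := by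
    rw [den, tailT]
    simp [eval]
  have h' (y : M.C ty0) : M.den tailAtT c i x m y = 0 ↔ (m < y → c (code x y) = i) := by
    rw [den, tailAtT]
    simp [eval, den_eqT, suc_sub_eq_zero]
  simp only [h, hμ.den_forallT, h']

theorem IsMu.den_limitT_of (hμ : IsMu μ) {c : M.C ty1} {i x m : M.C ty0}
    (h : ∀ y, m < y → c (code x y) = i) : M.den limitT μ c i x = 0 := by
  have h1 : M.den limitT μ c i x = M.den tailT μ c i x (μ (M.den tailT μ c i x)) := by
    rw [den, limitT, modulusT]
    simp [eval]
  rw [h1]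
  exact hμ _ ⟨m, (hμ.den_tailT c i x m).2 h⟩

theorem IsMu.den_limitT_apply (hμ : IsMu μ) {c : M.C ty1} {i x y : M.C ty0}
    (h : M.den limitT μ c i x = 0) (hy : M.den modulusT μ c i x < y) : c (code x y) = i := by
  have h1 : M.den limitT μ c i x = M.den tailT μ c i x (M.den modulusT μ c i x) := by
    rw [den, limitT]
    simp [eval]
  rw [h1, hμ.den_tailT] at h
  exact h y hy

theorem den_candidateT (c : M.C ty1) (i k x : M.C ty0) :
    M.den candidateT μ c i k x = 0 ↔ k < x ∧ M.den limitT μ c i x = 0 := by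
  rw [den, candidateT]
  simp [eval, add_eq_zero, suc_sub_eq_zero]

theorem IsMu.den_hasNextT (hμ : IsMu μ) (c : M.C ty1) (i k : M.C ty0) :
    M.den hasNextT μ c i k = 0 ↔ ∃ x, k < x ∧ M.den limitT μ c i x = 0 := by
  have h : M.den hasNextT μ c i k = M.den candidateT μ c i k (μ (M.den candidateT μ c i k)) := by
    rw [den, hasNextT, nextT]
    simp [eval]
  rw [h]
  exact ⟨fun h => ⟨_, (den_candidateT c i k _).1 h⟩,
    fun ⟨x, hx⟩ => hμ _ ⟨x, (den_candidateT c i k x).2 hx⟩⟩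

theorem den_nextT {c : M.C ty1} {i k : M.C ty0} (h : M.den hasNextT μ c i k = 0) :
    k < M.den nextT μ c i k ∧ M.den limitT μ c i (M.den nextT μ c i k) = 0 := by
  rw [← den_candidateT, ← h]
  symm
  rw [den, hasNextT]
  simp [eval]

/-- If only boundedly many numbers have limit colour `1`, all numbers beyond the bound have limit
colour `0`. -/
theorem IsMu.den_colourT (hμ : IsMu μ) {c : M.C ty1} (hc : IsStable c) (k : M.C ty0) :
    M.den hasNextT μ c (M.den colourT μ c) k = 0 := by
  have h : M.den colourT μ c =
      if M.den forallT μ (M.den hasNextT μ c (suc 0)) = 0 then suc 0 else 0 := by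
    rw [den, colourT]
    simp [eval]
  simp only [hμ.den_forallT] at h
  split_ifs at h with h1
  · rw [h]
    exact h1 k
  · rw [h, hμ.den_hasNextT]
    push Not at h1
    obtain ⟨n, hn⟩ := h1
    have hn' : ∀ x, n < x → M.den limitT μ c (suc 0) x ≠ 0 := fun x hx h2 =>
      hn ((hμ.den_hasNextT c _ n).2 ⟨x, hx, h2⟩)
    let x := suc (max k n)
    have hkn : max k n < x := lt_suc_self _
    refine ⟨x, (le_max_left _ _).trans_lt hkn, ?_⟩
    obtain ⟨i, m, him⟩ := hc.2 x
    -- The tail predicate omits the condition `x < y`, so the modulus is raised above `x`.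
    have hm : ∀ y, max x m < y → c (code x y) = i := fun y hy =>
      him y ((le_max_left _ _).trans_lt hy) ((le_max_right _ _).trans_lt hy)
    -- Stability alone does not say that the limit `i` is `0` or `1`; the colour of one pair in the
    -- tail does.
    have hlt : max x m < suc (max x m) := lt_suc_self _
    rcases hc.1 x _ ((le_max_left _ _).trans_lt hlt) with h2 | h2
    · rw [hm _ hlt] at h2
      subst h2
      exact hμ.den_limitT_of hm
    · rw [hm _ hlt] at h2
      subst h2
      exact (hn' x ((le_max_right _ _).trans_lt hkn) (hμ.den_limitT_of hm)).elim

theorem den_enumT_zero (c : M.C ty1) :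
    M.den enumT μ c 0 = M.den nextT μ c (M.den colourT μ c) 0 := by
  rw [den, enumT]
  simp [eval]

theorem den_enumT_suc (c : M.C ty1) (n : M.C ty0) :
    M.den enumT μ c (suc n) = M.den nextT μ c (M.den colourT μ c)
      (M.den enumT μ c n + M.den modulusT μ c (M.den colourT μ c) (M.den enumT μ c n)) := by
  have h (n : M.C ty0) : M.den enumT μ c n = M.rec0 n
      (M.den nextT μ c (M.den colourT μ c) 0) (M.den enumStepT μ c) := by
    rw [den, enumT]
    simp [eval]
  have h' (r i : M.C ty0) : M.den enumStepT μ c r i = M.den nextT μ c (M.den colourT μ c)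
      (r + M.den modulusT μ c (M.den colourT μ c) r) := by
    rw [den, enumStepT]
    simp [eval]
  simp only [h, rec0_suc, h']

theorem IsMu.lt_enumT_suc (hμ : IsMu μ) {c : M.C ty1} (hc : IsStable c) (n : M.C ty0) :
    M.den enumT μ c n + M.den modulusT μ c (M.den colourT μ c) (M.den enumT μ c n) <
      M.den enumT μ c (suc n) := by
  rw [den_enumT_suc]
  exact (den_nextT (hμ.den_colourT hc _)).1

/-- No induction is required: a next number of the chosen colour exists above every bound, whatever
the previous value was. -/
theorem IsMu.limitT_enumT (hμ : IsMu μ) {c : M.C ty1} (hc : IsStable c) (n : M.C ty0) :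
    M.den limitT μ c (M.den colourT μ c) (M.den enumT μ c n) = 0 := by
  rcases eq_zero_or_suc n with rfl | ⟨n, rfl⟩
  · rw [den_enumT_zero]
    exact (den_nextT (hμ.den_colourT hc _)).2
  · rw [den_enumT_suc]
    exact (den_nextT (hμ.den_colourT hc _)).2

/-- The bound is on the value at `suc a`, since the enumeration is known to pass the modulus of its
`a`th element exactly there. -/
theorem apply_suc_le {f : M.C ty1} (hf : ∀ n, f n < f (suc n)) {a b : M.C ty0} (h : a < b) :
    f (suc a) ≤ f b := by
  obtain ⟨d, rfl⟩ := lt_iff_suc_le.1 h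
  rw [← sub_eq_zero]
  refine induction_eq (F := fun d => f (suc a) - f (suc a + d)) (G := fun _ => 0)
    ((Rep.const _).sub (Rep.app_const f ((Rep.const _).add .id))) (Rep.const 0) ?_
    (fun d h => ?_) d
  · simp only [add_zero]
    exact sub_eq_zero.2 le_rfl
  · rw [sub_eq_zero] at h ⊢
    rw [add_suc]
    exact h.trans (hf _).le

theorem self_le_apply {f : M.C ty1} (hf : ∀ n, f n < f (suc n)) (n : M.C ty0) : n ≤ f n := by
  rw [← sub_eq_zero]
  refine induction_eq (F := fun n => n - f n) (G := fun _ => 0) (Rep.id.sub (Rep.app_const f .id))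
    (Rep.const 0) (zero_sub _) (fun n h => ?_) n
  rw [sub_eq_zero] at h ⊢
  exact lt_iff_suc_le.1 (h.trans_lt (hf n))

theorem IsMu.den_homogeneousT (hμ : IsMu μ) (c : M.C ty1) (x : M.C ty0) :
    M.den homogeneousT μ c x = if ∃ n, M.den enumT μ c n = x then suc 0 else 0 := by
  have h : M.den homogeneousT μ c x =
      if M.den isValueT μ c x (μ (M.den isValueT μ c x)) = 0 then suc 0 else 0 := by
    rw [den, homogeneousT]
    simp [eval]
  have h' (n : M.C ty0) : M.den isValueT μ c x n = 0 ↔ M.den enumT μ c n = x := by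
    rw [den, isValueT]
    simp [eval, den_eqT]
  rw [h]
  exact if_congr ⟨fun h1 => ⟨_, (h' _).1 h1⟩, fun ⟨n, hn⟩ => hμ _ ⟨n, (h' n).2 hn⟩⟩ rfl rfl

theorem IsMu.isUsrt_homogeneousT (hμ : IsMu μ) : IsUsrt (M.den homogeneousT μ) := by
  intro c hc
  have hlt (n : M.C ty0) : M.den enumT μ c n < M.den enumT μ c (suc n) :=
    (le_add_right _ _).trans_lt (hμ.lt_enumT_suc hc n)
  have hmem (x : M.C ty0) : M.den homogeneousT μ c x = suc 0 ↔ ∃ n, M.den enumT μ c n = x := by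
    rw [hμ.den_homogeneousT]
    split_ifs with h
    · simpa using h
    · simpa [(suc_ne_zero _).symm] using h
  refine ⟨fun n => ?_, fun k => ?_, M.den colourT μ c, fun x y hx hy hxy => ?_⟩
  · rw [hμ.den_homogeneousT]
    split_ifs <;> simp
  · exact ⟨_, (self_le_apply hlt k).trans_lt (hlt k), (hmem _).2 ⟨_, rfl⟩⟩
  · obtain ⟨a, rfl⟩ := (hmem x).1 hx
    obtain ⟨b, rfl⟩ := (hmem y).1 hy
    -- The enumeration is strictly increasing, so the order of the values determines that of the
    -- indices.
    have hab : a < b := by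
      by_contra h
      rcases (not_lt.1 h).eq_or_lt with rfl | h1
      · exact lt_irrefl _ hxy
      · exact lt_asymm hxy ((hlt b).trans_le (apply_suc_le hlt h1))
    refine hμ.den_limitT_apply (hμ.limitT_enumT hc a) ?_
    exact ((le_add_left _ _).trans_lt (hμ.lt_enumT_suc hc a)).trans_le (apply_suc_le hlt hab)

end Model
end HigherOrderRM

/-! ### The equivalence and its explicit forms -/

theorem mainTheorem12 :
    -- the equivalence
    RCA0ω (USRT22.iff Mu2) ∧
    -- explicitness of `USRT²₂ → (μ²)`: a search functional `Θ` exists, and `t(Ψ, Θ)` is as in `(μ²)`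
    RCA0ω (.all ty11 (usrt (.var ty11 0) ⟶ₘ .ex ty11 searches)) ∧
    (∃ t : Tm (ty11 ⇒ ty11 ⇒ ty2), t.Closed ∧
      RCA0ω (.all ty11 (.all ty11 (usrt (.var ty11 1) ⋏ searches ⟶ₘ
        mu (t ⬝ .var ty11 1 ⬝ .var ty11 0))))) ∧
    -- explicitness of `(μ²) → USRT²₂`
    (∃ s : Tm (ty2 ⇒ ty11), s.Closed ∧
      RCA0ω (.all ty2 (mu (.var ty2 0) ⟶ₘ usrt (s ⬝ .var ty2 0)))) := by
  refine ⟨.of_sat fun M v => ?_, .of_sat fun M v => ?_,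
    ⟨muOfSearchT, muOfSearchT_closed, .of_sat fun M v => ?_⟩,
    ⟨homogeneousT, homogeneousT_closed, .of_sat fun M v => ?_⟩⟩
  · simp only [USRT22, Mu2, Model.sat_iff, Model.sat_ex, Model.sat_usrt, Model.sat_mu, Str.eval,
      Str.Val.cons_zero]
    exact ⟨fun ⟨Ψ, hΨ⟩ => hΨ.exists_isMu, fun ⟨μ, hμ⟩ => ⟨_, hμ.isUsrt_homogeneousT⟩⟩
  · simp only [Str.Sat, Model.sat_ex, Model.sat_usrt, Model.sat_searches, Str.eval,
      Str.Val.cons_zero]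
    intro Ψ hΨ
    -- The search functional is obtained by way of `μ`, which quantifier-free choice has already
    -- extracted from `Ψ`.
    obtain ⟨μ, hμ⟩ := hΨ.exists_isMu
    exact hμ.exists_searches hΨ
  · simp only [Str.Sat, Model.sat_and, Model.sat_usrt, Model.sat_searches, Model.sat_mu, Str.eval,
      Model.eval_muOfSearchT]
    exact fun Ψ Θ ⟨hΨ, hΘ⟩ => hΨ.isMu_muOfSearchT hΘ
  · simp only [Str.Sat, Model.sat_usrt, Model.sat_mu, Str.eval, Model.eval_homogeneousT,
      Str.Val.cons_zero]
    exact fun μ hμ => hμ.isUsrt_homogeneousT
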